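/- Let $M$ be an oriented smooth $4$-manifold (not necessarily compact). For a Riemannian metric $g$ on $M$ let $*$ be the Hodge star of $g$ and the orientation (normalized by $\alpha\wedge *\beta=\langle\alpha,\beta\rangle\,\mathrm{vol}_g$), and for a bilinear form $B$ let $S(B)(u,v)=\tfrac12(B(u,v)+B(v,u))$. For an affine connection $\nabla$ with curvature $R(X,Y)Z=\nabla_X\nabla_YZ-\nabla_Y\nabla_XZ-\nabla_{[X,Y]}Z$ put $\mathrm{Ric}^\nabla(u,v)=\mathrm{tr}(w\mapsto R(w,u)v)$. Given a smooth $3$-form $H$, let $\nabla$ be the metric connection with skew torsion $H$, i.e. $\nabla g=0$ and $g(\nabla_XY-\nabla_YX-[X,Y],Z)=H(X,Y,Z)$. Then $(M,g,H)$ is called an *Einstein manifold with skew torsion* if $$Z^\nabla+S(\nabla{*H})+\frac{*dH}{4}\,g=0,$$ where $Z^\nabla=S(\mathrm{Ric}^\nabla)-\tfrac14\,\mathrm{tr}_g\big(\mathrm{Ric}^\nabla\big)\,g$ is the trace-free symmetric part of $\mathrm{Ric}^\nabla$. A conformal structure is a class $[g]$ of Riemannian metrics modulo $g\sim e^fg$,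 $f\in C^\infty(M)$. A Weyl connection on $(M,[g])$ is a torsion-free affine connection $D$ such that for every metric $g'\in[g]$ there is a smooth $1$-form $\omega'$ with $Dg'=\omega'\otimes g'$. It is *Einstein–Weyl* if the trace-free symmetric part of $\mathrm{Ric}^D$ vanishes. **Theorem.** 1. Let $(M,g,H)$ be an Einstein manifold with skew torsion and let $\omega=*H$. Then there is a unique torsion-free connection $D$ with $Dg=\omega\otimes g$, and $D$ is an Einstein–Weyl connection on $(M,[g])$. 2. Conversely, let $D$ be an Einstein–Weyl connection on $M$ with a conformal structure $c$. For every metric $g\in c$, with $1$-form $\omega$ given by $Dg=\omega\otimes g$, the triple $(M,g,-{*\omega})$ is an Einstein manifold with skew torsion. -/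

import Mathlib

open scoped Manifold ContDiff Topology Bundle
open Module

noncomputable section

/-! ### Linear algebra: contraction, Hodge star, trace -/

lemma append_update_right {V : Type*} {k m : ℕ} [DecidableEq (Fin m)] (u : Fin k → V) (w : Fin m → V) (i : Fin m)
    (z : V) : Fin.append u (Function.update w i z)
      = Function.update (Fin.append u w) (Fin.natAdd k i) z := by
  ext j
  refine Fin.addCases (fun a => ?_) (fun b => ?_) j
  · have h : Fin.castAdd m a ≠ Fin.natAdd k i := by
      intro h
      have := congrArg Fin.val h
      simp at this
      omega
    simp [Function.update_of_ne h]
  · by_cases h : b = i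
    · subst h; simp
    · have h' : Fin.natAdd k b ≠ Fin.natAdd k i := by simpa using h
      simp [Function.update_of_ne h, Function.update_of_ne h']

/-- Contraction of an alternating `n`-form with `k` vectors in its first `k` slots. -/
def contractForm {V : Type*} [AddCommGroup V] [Module ℝ V] {k m n : ℕ} (h : k + m = n)
    (φ : V [⋀^Fin n]→ₗ[ℝ] ℝ) (u : Fin k → V) : V [⋀^Fin m]→ₗ[ℝ] ℝ where
  toFun w := φ (Fin.append u w ∘ Fin.cast h.symm)
  map_update_add' w i x y := by
    subst h
    simp [append_update_right]
  map_update_smul' w i c x := by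
    subst h
    simp [append_update_right]
  map_eq_zero_of_eq' w i j hw hij := by
    subst h
    refine φ.map_eq_zero_of_eq (i := Fin.natAdd k i) (j := Fin.natAdd k j) _ ?_ ?_
    · simpa using hw
    · simpa using hij

/-- Some orthonormal basis, indexed by `Fin n`, of an `n`-dimensional inner product space. -/
def orthoBasis (V : Type*) [NormedAddCommGroup V] [InnerProductSpace ℝ V]
    [FiniteDimensional ℝ V] {n : ℕ} (hn : finrank ℝ V = n) : OrthonormalBasis (Fin n) ℝ V :=
  (stdOrthonormalBasis ℝ V).reindex (finCongr hn)

/-- The Hodge star of a `k`-form `α` (given by its values on `k`-tuples) on an oriented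
inner product space of dimension `n = k + m`:
`⋆α = ∑_I α(e_{I₁}, …, e_{I_k}) vol(e_{I₁}, …, e_{I_k}, ·)`, the sum over increasing
multi-indices, for an orthonormal basis `e`. It is characterized by `α ∧ ⋆β = ⟨α, β⟩ vol`. -/
def hodgeStar {V : Type*} [NormedAddCommGroup V] [InnerProductSpace ℝ V]
    [FiniteDimensional ℝ V] {k m n : ℕ} (h : k + m = n) (hn : finrank ℝ V = n)
    (o : Orientation ℝ V (Fin n)) (α : (Fin k → V) → ℝ) : V [⋀^Fin m]→ₗ[ℝ] ℝ :=
  haveI : Fact (finrank ℝ V = n) := ⟨hn⟩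
  ∑ I : Fin k → Fin n with StrictMono I,
    α (fun j => orthoBasis V hn (I j)) •
      contractForm h o.volumeForm (fun j => orthoBasis V hn (I j))

/-- The symmetrization `S(B)(u, v) = (B(u, v) + B(v, u)) / 2`. -/
def symPart {V : Type*} (B : V → V → ℝ) (u v : V) : ℝ := (B u v + B v u) / 2

/-! ### Metrics, forms and orientations on a 4-manifold -/

section Manifold

/-- The model space of 4-manifolds. -/
abbrev E4 : Type := EuclideanSpace ℝ (Fin 4)

lemma finrank_tangent {M : Type*} [TopologicalSpace M] [ChartedSpace E4 M] (x : M) : finrank ℝ (TangentSpace (𝓡 4) x) = 4 :=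
  finrank_euclideanSpace_fin

variable {M : Type*} [TopologicalSpace M] [ChartedSpace E4 M] [IsManifold (𝓡 4) ∞ M]

/-- Smooth Riemannian metrics on `M`. -/
abbrev Metric4 (M : Type*) [TopologicalSpace M] [ChartedSpace E4 M] [IsManifold (𝓡 4) ∞ M] :=
  Bundle.ContMDiffRiemannianMetric (𝓡 4) ∞ E4 (fun x : M => TangentSpace (𝓡 4) x)

/-- Affine connections on `M`. -/
abbrev Connection4 (M : Type*) [TopologicalSpace M] [ChartedSpace E4 M]
    [IsManifold (𝓡 4) ∞ M] :=
  CovariantDerivative (𝓡 4) E4 (fun x : M => TangentSpace (𝓡 4) x)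

/-- Vector fields on `M` (smoothness is a separate condition). -/
abbrev VectorField4 (M : Type*) [TopologicalSpace M] [ChartedSpace E4 M] :=
  Π x : M, TangentSpace (𝓡 4) x

/-- `k`-forms on `M` (smoothness is a separate condition). -/
abbrev Form4 (M : Type*) [TopologicalSpace M] [ChartedSpace E4 M] (k : ℕ) :=
  Π x : M, TangentSpace (𝓡 4) x [⋀^Fin k]→ₗ[ℝ] ℝ

/-- A form is smooth if it takes smooth values on smooth local vector fields. -/
def IsSmoothForm {k : ℕ} (α : Form4 M k) : Prop :=
  ∀ (u : Set M) (X : Fin k → VectorField4 M), IsOpen u →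
    (∀ i, ContMDiffOn (𝓡 4) (𝓡 4).tangent ∞ (fun x => (⟨x, X i x⟩ : TangentBundle (𝓡 4) M)) u) →
    ContMDiffOn (𝓡 4) 𝓘(ℝ) ∞ (fun x => α x (fun i => X i x)) u

/-- A connection is smooth if it maps smooth local vector fields to smooth local sections
of `Hom(TM, TM)`. -/
def IsSmoothConnection (D : Connection4 M) : Prop :=
  ∀ u : Set M, IsOpen u → ContMDiffCovariantDerivativeOn E4 ∞ D.toFun u

variable (M) in
/-- An orientation of `M`: a choice of orientation of each tangent space which near every point
is the one given by some smooth local frame. -/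
structure ManifoldOrientation where
  orient : Π x : M, Orientation ℝ (TangentSpace (𝓡 4) x) (Fin 4)
  locally_frame : ∀ p : M, ∃ u ∈ 𝓝 p, ∃ (s : Fin 4 → VectorField4 M)
    (hs : IsLocalFrameOn (𝓡 4) E4 ∞ s u), ∀ (x : M) (hx : x ∈ u),
      (hs.toBasisAt hx).orientation = orient x

/-- The extension of a tangent vector at `p` to a vector field, smooth near `p`. -/
abbrev ext4 {p : M} (v : TangentSpace (𝓡 4) p) : VectorField4 M := FiberBundle.extend E4 v

/-- The Hodge star of `(M, g)` with the orientation `o`, on `k`-forms, `k + m = 4`. -/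
def star4 (o : ManifoldOrientation M) (g : Metric4 M) {k m : ℕ} (h : k + m = 4)
    (α : Π x : M, (Fin k → TangentSpace (𝓡 4) x) → ℝ) : Form4 M m := fun x =>
  letI : Bundle.RiemannianBundle (fun x : M => TangentSpace (𝓡 4) x) := ⟨g.toRiemannianMetric⟩
  haveI : FiniteDimensional ℝ (TangentSpace (𝓡 4) x) :=
    .of_finrank_pos (by rw [finrank_tangent]; norm_num)
  hodgeStar h (finrank_tangent x) (o.orient x) (α x)

/-- The trace of a bilinear form on `T_xM` with respect to `g`. -/
def metricTrace (g : Metric4 M) (x : M)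
    (B : TangentSpace (𝓡 4) x → TangentSpace (𝓡 4) x → ℝ) : ℝ :=
  letI : Bundle.RiemannianBundle (fun x : M => TangentSpace (𝓡 4) x) := ⟨g.toRiemannianMetric⟩
  haveI : FiniteDimensional ℝ (TangentSpace (𝓡 4) x) :=
    .of_finrank_pos (by rw [finrank_tangent]; norm_num)
  ∑ i, B (orthoBasis (TangentSpace (𝓡 4) x) (finrank_tangent x) i)
    (orthoBasis (TangentSpace (𝓡 4) x) (finrank_tangent x) i)

/-- The symmetric trace-free part of a bilinear form on `T_xM` with respect to `g`. -/
def symTraceFree (g : Metric4 M) (x : M)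
    (B : TangentSpace (𝓡 4) x → TangentSpace (𝓡 4) x → ℝ) (u v : TangentSpace (𝓡 4) x) : ℝ :=
  symPart B u v - metricTrace g x (symPart B) / 4 * g.inner x u v

/-- The exterior derivative of a smooth `(n + 1)`-form, by the invariant formula
`dα(V₀, …) = ∑ (-1)^i V_i(α(…, V̂_i, …)) + ∑_{i < j} (-1)^{i+j} α([V_i, V_j], …, V̂_i, …, V̂_j, …)`.
In the second sum the pair `(i, j)`, `i ≤ j`, stands for `(i, j + 1)`, hence the minus sign. -/
def extDeriv4 {n : ℕ} (α : Form4 M (n + 1)) (p : M) (v : Fin (n + 2) → TangentSpace (𝓡 4) p) :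
    ℝ :=
  (∑ i : Fin (n + 2), (-1) ^ i.val *
      mvfderiv (𝓡 4) (fun x => α x (i.removeNth fun l => ext4 (v l) x)) p (v i)) -
    ∑ i : Fin (n + 1), ∑ j ≥ i, (-1) ^ (i + j : ℕ) *
      α p (Matrix.vecCons
        (VectorField.mlieBracket (𝓡 4) (ext4 (v i.castSucc)) (ext4 (v j.succ)) p)
        (j.removeNth (i.castSucc.removeNth v)))

/-! ### Connections -/

/-- The covariant derivative of a 1-form, `(D_u h)(v) = u(h(V)) - h(D_u V)`. -/
def covDerivOneForm (D : Connection4 M) (h : Form4 M 1) (p : M) (u v : TangentSpace (𝓡 4) p) :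
    ℝ :=
  mvfderiv (𝓡 4) (fun x => h x ![ext4 v x]) p u - h p ![D (ext4 v) p u]

/-- The covariant derivative of a metric, `(D_u g)(Y, Z) = u(g(Y, Z)) - g(D_u Y, Z) - g(Y, D_u Z)`
at `p`. -/
def covDerivMetric (D : Connection4 M) (g : Metric4 M) (Y Z : VectorField4 M) (p : M)
    (u : TangentSpace (𝓡 4) p) : ℝ :=
  mvfderiv (𝓡 4) (fun x => g.inner x (Y x) (Z x)) p u
    - g.inner p (D Y p u) (Z p) - g.inner p (Y p) (D Z p u)

/-- The condition `D g = θ ⊗ g`. -/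
def HasMetricDeriv (D : Connection4 M) (g : Metric4 M) (θ : Form4 M 1) : Prop :=
  ∀ (p : M) (Y Z : VectorField4 M),
    MDifferentiableAt (𝓡 4) (𝓡 4).tangent (fun x => (⟨x, Y x⟩ : TangentBundle (𝓡 4) M)) p →
    MDifferentiableAt (𝓡 4) (𝓡 4).tangent (fun x => (⟨x, Z x⟩ : TangentBundle (𝓡 4) M)) p →
    ∀ u : TangentSpace (𝓡 4) p,
      covDerivMetric D g Y Z p u = θ p ![u] * g.inner p (Y p) (Z p)

/-- The curvature `R(X, Y)Z = D_X D_Y Z - D_Y D_X Z - D_{[X, Y]} Z`. -/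
def curvature4 (D : Connection4 M) (X Y Z : VectorField4 M) (p : M) : TangentSpace (𝓡 4) p :=
  D (fun x => D Z x (Y x)) p (X p) - D (fun x => D Z x (X x)) p (Y p)
    - D Z p (VectorField.mlieBracket (𝓡 4) X Y p)

/-- The standard basis of the tangent space `T_pM`, given by the preferred chart at `p`. -/
def tangentBasis (p : M) : Basis (Fin 4) ℝ (TangentSpace (𝓡 4) p) :=
  (EuclideanSpace.basisFun (Fin 4) ℝ).toBasis

/-- The Ricci tensor `Ric(u, v) = tr (w ↦ R(w, u)v)`. -/
def ricci4 (D : Connection4 M) (p : M) (u v : TangentSpace (𝓡 4) p) : ℝ :=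
  ∑ i, (tangentBasis p).repr
    (curvature4 D (ext4 (tangentBasis p i)) (ext4 u) (ext4 v) p) i

/-! ### Einstein metrics with skew torsion -/

/-- `D` is the metric connection of `(M, g)` with skew torsion the 3-form `H`. -/
structure IsSkewTorsionConnection (g : Metric4 M) (H : Form4 M 3) (D : Connection4 M) : Prop where
  smooth : IsSmoothConnection D
  metric : HasMetricDeriv D g 0
  torsion : ∀ (p : M) (u v w : TangentSpace (𝓡 4) p), g.inner p (D.torsion p u v) w = H p ![u, v, w]

/-- `(M, g, H)` is an Einstein manifold with skew torsion: `H` is a smooth 3-form and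
`Z^D + S(D ⋆H) + (⋆dH / 4) g = 0` for the metric connection `D` with skew torsion `H`,
where `Z^D` is the symmetric trace-free part of `Ric^D`. -/
def IsEinsteinSkewTorsion (o : ManifoldOrientation M) (g : Metric4 M) (H : Form4 M 3) : Prop :=
  IsSmoothForm H ∧ ∃ D : Connection4 M, IsSkewTorsionConnection g H D ∧
    ∀ (p : M) (u v : TangentSpace (𝓡 4) p),
      symTraceFree g p (ricci4 D p) u v
        + symPart (covDerivOneForm D (star4 o g (k := 3) (m := 1) rfl fun x => H x) p) u v
        + star4 o g (k := 4) (m := 0) rfl (extDeriv4 H) p ![] / 4 * g.inner p u v = 0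

/-! ### Conformal structures and Einstein–Weyl geometry -/

/-- Conformal equivalence of metrics: `g' = e^f g` for a smooth function `f`. -/
def conformalSetoid (M : Type*) [TopologicalSpace M] [ChartedSpace E4 M]
    [IsManifold (𝓡 4) ∞ M] : Setoid (Metric4 M) where
  r g g' := ∃ f : M → ℝ, ContMDiff (𝓡 4) 𝓘(ℝ) ∞ f ∧
    ∀ x, g'.inner x = Real.exp (f x) • g.inner x
  iseqv :=
    { refl := fun g => ⟨fun _ => 0, contMDiff_const, fun x => by simp⟩
      symm := by
        rintro g g' ⟨f, hf, h⟩
        refine ⟨fun x => -f x, hf.neg, fun x => ?_⟩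
        rw [h x, smul_smul, ← Real.exp_add]
        simp
      trans := by
        rintro g g' g'' ⟨f, hf, h⟩ ⟨f', hf', h'⟩
        refine ⟨fun x => f' x + f x, hf'.add hf, fun x => ?_⟩
        rw [h' x, h x, smul_smul, ← Real.exp_add] }

/-- Conformal structures on `M`. -/
def ConformalStructure (M : Type*) [TopologicalSpace M] [ChartedSpace E4 M]
    [IsManifold (𝓡 4) ∞ M] := Quotient (conformalSetoid M)

/-- The conformal class `[g]`. -/
def conformalClass (g : Metric4 M) : ConformalStructure M := Quotient.mk (conformalSetoid M) g

/-- `D` is a Weyl connection of the conformal manifold `(M, c)`. -/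
structure IsWeylConnection (c : ConformalStructure M) (D : Connection4 M) : Prop where
  smooth : IsSmoothConnection D
  torsion_free : D.torsion = 0
  metric : ∀ g : Metric4 M, conformalClass g = c →
    ∃ θ : Form4 M 1, IsSmoothForm θ ∧ HasMetricDeriv D g θ

/-- `(M, c, D)` is Einstein–Weyl: the trace-free symmetric part of `Ric^D` vanishes. -/
structure IsEinsteinWeyl (c : ConformalStructure M) (D : Connection4 M) : Prop where
  weyl : IsWeylConnection c D
  einstein : ∀ g : Metric4 M, conformalClass g = c →
    ∀ (p : M) (u v : TangentSpace (𝓡 4) p), symTraceFree g p (ricci4 D p) u v = 0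

end Manifold

end

/-! Write `ξ` for the vector field dual to `ω`. Since `⋆⋆ = -1` on forms of odd degree in dimension
four, `ω = ⋆H` is the same as `H = -⋆ω = -vol(ξ, ·, ·, ·)`. The metric connection `N` with torsion
`H` and the torsion-free connection `D` with `Dg = ω ⊗ g` then differ by the explicit tensor `D_u Y
- N_u Y = ½(ξ × u × Y - ω(u)Y - ω(Y)u + g(u, Y)ξ)`, where `×` is the triple cross product
(`weylTensor`, `IsWeylShift`). Its part skew in `u, Y` removes the torsion, and its part not skew
for `g` gives `ω ⊗ g`. So the two kinds of connections correspond, and both halves of the theorem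
reduce to one identity between their Ricci tensors.

The difference tensor is built from `g`, `vol` and `ξ`, and `g` and `vol` are `N`-parallel
(`vol4_deriv`, `weylTensor_deriv`). Hence the curvatures differ by a term linear in `Nξ`, a torsion
term and a commutator (`IsWeylShift.curvature4_eq`). After tracing and symmetrizing, the terms
quadratic in `ξ` cancel and the linear ones leave `S(Nω) + ½ (div ξ) g`, where `div ξ = tr Nξ`
(`weylTensor_trace`). On the other side `⋆dH = -div ξ` (`star4_extDeriv4`). Passing to trace-free
parts, the trace-free symmetric part of `Ric^D` is exactly the left-hand side of the Einstein
equation with skew torsion (`IsWeylShift.symTraceFree_ricci4`).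

What remains is uniqueness of `D` (`connection_unique`), independence of the metric within the
conformal class (`isEinsteinWeyl_conformalClass`), and smoothness. The Hodge star is defined with an
orthonormal basis chosen at each point without any continuity, so smoothness is always tested
against local smooth orthonormal frames (`exists_orthonormal_frame`). -/

noncomputable section
-- Orthonormal bases of a tangent space and the volume form.
section
variable {M : Type*} [TopologicalSpace M] [ChartedSpace E4 M] [IsManifold (𝓡 4) ∞ M]

/-- The volume form of an oriented Riemannian 4-manifold. -/
def vol4 (o : ManifoldOrientation M) (g : Metric4 M) (x : M) :
    TangentSpace (𝓡 4) x [⋀^Fin 4]→ₗ[ℝ] ℝ :=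
  letI : Bundle.RiemannianBundle (fun x : M => TangentSpace (𝓡 4) x) := ⟨g.toRiemannianMetric⟩
  haveI : FiniteDimensional ℝ (TangentSpace (𝓡 4) x) :=
    .of_finrank_pos (by rw [finrank_tangent]; norm_num)
  haveI : Fact (finrank ℝ (TangentSpace (𝓡 4) x) = 4) := ⟨finrank_tangent x⟩
  (o.orient x).volumeForm

/-- The orthonormal basis of `T_xM` used in the definition of the Hodge star. -/
def onBasis (g : Metric4 M) (x : M) : Fin 4 → TangentSpace (𝓡 4) x :=
  letI : Bundle.RiemannianBundle (fun x : M => TangentSpace (𝓡 4) x) := ⟨g.toRiemannianMetric⟩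
  haveI : FiniteDimensional ℝ (TangentSpace (𝓡 4) x) :=
    .of_finrank_pos (by rw [finrank_tangent]; norm_num)
  orthoBasis (TangentSpace (𝓡 4) x) (finrank_tangent x)

/-- Orthonormal families of four tangent vectors. -/
def IsOrthonormal4 (g : Metric4 M) (x : M) (e : Fin 4 → TangentSpace (𝓡 4) x) : Prop :=
  ∀ i j, g.inner x (e i) (e j) = if i = j then 1 else 0

lemma isOrthonormal4_onBasis (g : Metric4 M) (x : M) : IsOrthonormal4 g x (onBasis g x) := by
  let : Bundle.RiemannianBundle (fun x : M => TangentSpace (𝓡 4) x) := ⟨g.toRiemannianMetric⟩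
  have : FiniteDimensional ℝ (TangentSpace (𝓡 4) x) :=
    .of_finrank_pos (by rw [finrank_tangent]; norm_num)
  intro i j
  exact orthonormal_iff_ite.mp (orthoBasis (TangentSpace (𝓡 4) x) (finrank_tangent x)).orthonormal i j

lemma IsOrthonormal4.exists_basis (g : Metric4 M) {x : M} {e : Fin 4 → TangentSpace (𝓡 4) x}
    (he : IsOrthonormal4 g x e) :
    letI : Bundle.RiemannianBundle (fun x : M => TangentSpace (𝓡 4) x) := ⟨g.toRiemannianMetric⟩
    ∃ b : OrthonormalBasis (Fin 4) ℝ (TangentSpace (𝓡 4) x), ⇑b = e := by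
  let : Bundle.RiemannianBundle (fun x : M => TangentSpace (𝓡 4) x) := ⟨g.toRiemannianMetric⟩
  have : FiniteDimensional ℝ (TangentSpace (𝓡 4) x) :=
    .of_finrank_pos (by rw [finrank_tangent]; norm_num)
  have ho : Orthonormal ℝ e := orthonormal_iff_ite.mpr he
  have hs : ⊤ ≤ Submodule.span ℝ (Set.range e) := by
    rw [ho.linearIndependent.span_eq_top_of_card_eq_finrank]
    rw [finrank_tangent]; simp
  exact ⟨OrthonormalBasis.mk ho hs, OrthonormalBasis.coe_mk ho hs⟩

lemma IsOrthonormal4.sum_smul {g : Metric4 M} {x : M} {e : Fin 4 → TangentSpace (𝓡 4) x}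
    (he : IsOrthonormal4 g x e) (v : TangentSpace (𝓡 4) x) :
    ∑ i, g.inner x (e i) v • e i = v := by
  let : Bundle.RiemannianBundle (fun x : M => TangentSpace (𝓡 4) x) := ⟨g.toRiemannianMetric⟩
  obtain ⟨b, rfl⟩ := he.exists_basis
  exact b.sum_repr' v

lemma IsOrthonormal4.inner_eq {g : Metric4 M} {x : M} {e : Fin 4 → TangentSpace (𝓡 4) x}
    (he : IsOrthonormal4 g x e) (v w : TangentSpace (𝓡 4) x) :
    g.inner x v w = ∑ i, g.inner x (e i) v * g.inner x (e i) w := by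
  conv_lhs => rw [← he.sum_smul v]
  simp

/-- Both sides are the trace of `T`. The Ricci tensor is defined with the chart basis, while the
algebra below takes place in an orthonormal one. -/
lemma IsOrthonormal4.trace_eq {g : Metric4 M} {x : M} {e : Fin 4 → TangentSpace (𝓡 4) x}
    (he : IsOrthonormal4 g x e) (b : Basis (Fin 4) ℝ (TangentSpace (𝓡 4) x))
    (T : TangentSpace (𝓡 4) x →ₗ[ℝ] TangentSpace (𝓡 4) x) :
    ∑ i, b.repr (T (b i)) i = ∑ i, g.inner x (T (e i)) (e i) := by
  let : Bundle.RiemannianBundle (fun x : M => TangentSpace (𝓡 4) x) := ⟨g.toRiemannianMetric⟩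
  obtain ⟨c, rfl⟩ := he.exists_basis
  have h1 := LinearMap.trace_eq_matrix_trace ℝ b T
  have h2 := LinearMap.trace_eq_sum_inner T c
  rw [h1] at h2
  simp only [Matrix.trace, Matrix.diag, LinearMap.toMatrix_apply] at h2
  rw [h2]
  exact Finset.sum_congr rfl fun i _ => g.symm x _ _

/-- Top-degree forms are multiples of the determinant. The basis need not be positively oriented:
the factor `vol4 o g x e` is a sign, of which only the square being 1 is used in the algebra. -/
lemma IsOrthonormal4.vol4_eq (o : ManifoldOrientation M) {g : Metric4 M} {x : M}
    {e : Fin 4 → TangentSpace (𝓡 4) x} (he : IsOrthonormal4 g x e)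
    (v : Fin 4 → TangentSpace (𝓡 4) x) :
    vol4 o g x v = vol4 o g x e * Matrix.det (Matrix.of fun i j => g.inner x (e j) (v i)) := by
  let : Bundle.RiemannianBundle (fun x : M => TangentSpace (𝓡 4) x) := ⟨g.toRiemannianMetric⟩
  obtain ⟨c, rfl⟩ := he.exists_basis
  have h := congrArg (fun f => f v) (AlternatingMap.eq_smul_basis_det c.toBasis (vol4 o g x))
  have h2 : c.toBasis.det v = Matrix.det (Matrix.of fun i j => g.inner x (c j) (v i)) := by
    rw [Basis.det_apply, ← Matrix.det_transpose]
    congr 1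
    ext i j
    simp only [Matrix.transpose_apply, Basis.toMatrix_apply, Matrix.of_apply,
      OrthonormalBasis.coe_toBasis_repr_apply, OrthonormalBasis.repr_apply_apply]
    rfl
  rw [← h2]
  simpa using h

lemma IsOrthonormal4.vol4_sq (o : ManifoldOrientation M) {g : Metric4 M} {x : M}
    {e : Fin 4 → TangentSpace (𝓡 4) x} (he : IsOrthonormal4 g x e) :
    vol4 o g x e * vol4 o g x e = 1 := by
  let : Bundle.RiemannianBundle (fun x : M => TangentSpace (𝓡 4) x) := ⟨g.toRiemannianMetric⟩
  obtain ⟨c, rfl⟩ := he.exists_basis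
  have : FiniteDimensional ℝ (TangentSpace (𝓡 4) x) :=
    .of_finrank_pos (by rw [finrank_tangent]; norm_num)
  have : Fact (finrank ℝ (TangentSpace (𝓡 4) x) = 4) := ⟨finrank_tangent x⟩
  have := (o.orient x).abs_volumeForm_apply_of_orthonormal c
  change |vol4 o g x c| = 1 at this
  rw [← abs_mul_abs_self, this, one_mul]

/-- Links the local frames that define an orientation of `M` to the sign of the volume form. -/
lemma vol4_pos_of_orientation (o : ManifoldOrientation M) (g : Metric4 M) {x : M}
    (b : Basis (Fin 4) ℝ (TangentSpace (𝓡 4) x)) (hb : b.orientation = o.orient x) :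
    0 < vol4 o g x b := by
  let : Bundle.RiemannianBundle (fun x : M => TangentSpace (𝓡 4) x) := ⟨g.toRiemannianMetric⟩
  have : FiniteDimensional ℝ (TangentSpace (𝓡 4) x) :=
    .of_finrank_pos (by rw [finrank_tangent]; norm_num)
  have : Fact (finrank ℝ (TangentSpace (𝓡 4) x) = 4) := ⟨finrank_tangent x⟩
  let f := (o.orient x).finOrthonormalBasis (by norm_num) (finrank_tangent x)
  have hf : f.toBasis.orientation = o.orient x :=
    (o.orient x).finOrthonormalBasis_orientation (by norm_num) (finrank_tangent x)
  have h1 : vol4 o g x = f.toBasis.det := (o.orient x).volumeForm_robust f hf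
  rw [h1]
  exact (f.toBasis.orientation_eq_iff_det_pos b).mp (hf.trans hb.symm)

end
end

/-! ### Polynomial identities in orthonormal coordinates on `ℝ⁴`. -/

noncomputable section

/-- The determinant of four vectors of `ℝ⁴`. -/
def det4 (a b c d : Fin 4 → ℝ) : ℝ := Matrix.det (Matrix.of ![a, b, c, d])

lemma det4_eq (a b c d : Fin 4 → ℝ) : det4 a b c d =
    (a 0 * b 1 - a 1 * b 0) * (c 2 * d 3 - c 3 * d 2)
    - (a 0 * b 2 - a 2 * b 0) * (c 1 * d 3 - c 3 * d 1)
    + (a 0 * b 3 - a 3 * b 0) * (c 1 * d 2 - c 2 * d 1)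
    + (a 1 * b 2 - a 2 * b 1) * (c 0 * d 3 - c 3 * d 0)
    - (a 1 * b 3 - a 3 * b 1) * (c 0 * d 2 - c 2 * d 0)
    + (a 2 * b 3 - a 3 * b 2) * (c 0 * d 1 - c 1 * d 0) := by
  simp [det4, Matrix.det_succ_row_zero, Fin.sum_univ_succ, Fin.succAbove]
  ring

/-- The standard inner product of `ℝ⁴`. -/
def dot4 (a b : Fin 4 → ℝ) : ℝ := a 0 * b 0 + a 1 * b 1 + a 2 * b 2 + a 3 * b 3

/-- The components of the cross product of three vectors of `ℝ⁴`. -/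
def cross4 (a b c : Fin 4 → ℝ) (i : Fin 4) : ℝ := det4 a b c (Pi.single i 1)

/-- The components of the difference of a Weyl connection and a connection with skew torsion. -/
def weyl4 (s : ℝ) (a b c : Fin 4 → ℝ) (i : Fin 4) : ℝ :=
  (s * cross4 a b c i - dot4 a b * c i - dot4 a c * b i + dot4 b c * a i) / 2

lemma cross4_zero (a b c : Fin 4 → ℝ) : cross4 a b c 0 =
    -(a 1 * (b 2 * c 3 - b 3 * c 2) - a 2 * (b 1 * c 3 - b 3 * c 1)
      + a 3 * (b 1 * c 2 - b 2 * c 1)) := by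
  simp [cross4, det4_eq]; ring

lemma cross4_one (a b c : Fin 4 → ℝ) : cross4 a b c 1 =
    a 0 * (b 2 * c 3 - b 3 * c 2) - a 2 * (b 0 * c 3 - b 3 * c 0)
      + a 3 * (b 0 * c 2 - b 2 * c 0) := by
  simp [cross4, det4_eq]; ring

lemma cross4_two (a b c : Fin 4 → ℝ) : cross4 a b c 2 =
    -(a 0 * (b 1 * c 3 - b 3 * c 1) - a 1 * (b 0 * c 3 - b 3 * c 0)
      + a 3 * (b 0 * c 1 - b 1 * c 0)) := by
  simp [cross4, det4_eq]; ring

lemma cross4_three (a b c : Fin 4 → ℝ) : cross4 a b c 3 =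
    a 0 * (b 1 * c 2 - b 2 * c 1) - a 1 * (b 0 * c 2 - b 2 * c 0)
      + a 2 * (b 0 * c 1 - b 1 * c 0) := by
  simp [cross4, det4_eq]; ring

/-- The linear part of the difference of the Ricci tensors. -/
lemma weyl4_trace_linear (s : ℝ) (L : Fin 4 → Fin 4 → ℝ) (u v : Fin 4 → ℝ) :
    (∑ i, (weyl4 s (L i) u v i - weyl4 s (∑ j, u j • L j) (Pi.single i 1) v i)) +
    (∑ i, (weyl4 s (L i) v u i - weyl4 s (∑ j, v j • L j) (Pi.single i 1) u i)) =
    dot4 (∑ j, u j • L j) v + dot4 (∑ j, v j • L j) u + (∑ i, L i i) * dot4 u v := by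
  simp only [Fin.sum_univ_four, weyl4, dot4, cross4_zero, cross4_one, cross4_two, cross4_three,
    Pi.add_apply, Pi.smul_apply, smul_eq_mul, Pi.single_apply]
  simp
  ring

/-- The quadratic part of the difference of the Ricci tensors is skew-symmetric. -/
lemma weyl4_trace_quadratic {s : ℝ} (hs : s * s = 1) (a u v : Fin 4 → ℝ) :
    (∑ i, (weyl4 s a (-(s • cross4 a (Pi.single i 1) u)) v i
      + weyl4 s a (Pi.single i 1) (weyl4 s a u v) i
      - weyl4 s a u (weyl4 s a (Pi.single i 1) v) i)) +
    (∑ i, (weyl4 s a (-(s • cross4 a (Pi.single i 1) v)) u i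
      + weyl4 s a (Pi.single i 1) (weyl4 s a v u) i
      - weyl4 s a v (weyl4 s a (Pi.single i 1) u) i)) = 0 := by
  -- The cross products contribute terms with `s²`, which have to cancel terms free of `s`.
  -- Substituting `s = ±1` turns this into a polynomial identity.
  have h : s = 1 ∨ s = -1 := by
    rwa [← mul_self_eq_one_iff]
  rcases h with rfl | rfl <;>
  · simp only [Fin.sum_univ_four, weyl4, dot4, cross4_zero, cross4_one, cross4_two, cross4_three,
      Pi.neg_apply, Pi.smul_apply, smul_eq_mul, Pi.single_apply]
    simp
    ring

end

/-! ### Cross product, difference tensor, traces and Hodge stars at a point. -/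

noncomputable section
section
variable {M : Type*} [TopologicalSpace M] [ChartedSpace E4 M] [IsManifold (𝓡 4) ∞ M]

/-- The components of a tangent vector with respect to an orthonormal family. -/
def coord4 (g : Metric4 M) {x : M} (e : Fin 4 → TangentSpace (𝓡 4) x) (v : TangentSpace (𝓡 4) x) :
    Fin 4 → ℝ := fun i => g.inner x (e i) v

lemma coord4_add (g : Metric4 M) {x : M} (e : Fin 4 → TangentSpace (𝓡 4) x)
    (v w : TangentSpace (𝓡 4) x) : coord4 g e (v + w) = coord4 g e v + coord4 g e w := by
  ext i; simp [coord4]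

lemma coord4_sub (g : Metric4 M) {x : M} (e : Fin 4 → TangentSpace (𝓡 4) x)
    (v w : TangentSpace (𝓡 4) x) : coord4 g e (v - w) = coord4 g e v - coord4 g e w := by
  ext i; simp [coord4]

lemma coord4_smul (g : Metric4 M) {x : M} (e : Fin 4 → TangentSpace (𝓡 4) x) (c : ℝ)
    (v : TangentSpace (𝓡 4) x) : coord4 g e (c • v) = c • coord4 g e v := by
  ext i; simp [coord4]

lemma coord4_neg (g : Metric4 M) {x : M} (e : Fin 4 → TangentSpace (𝓡 4) x)
    (v : TangentSpace (𝓡 4) x) : coord4 g e (-v) = -coord4 g e v := by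
  ext i; simp [coord4]

lemma Metric4.ext_inner (g : Metric4 M) {x : M} {v w : TangentSpace (𝓡 4) x}
    (h : ∀ z, g.inner x v z = g.inner x w z) : v = w := by
  by_contra hne
  have h1 := g.pos x (v - w) (sub_ne_zero.mpr hne)
  simp [h] at h1

namespace IsOrthonormal4

variable {g : Metric4 M} {x : M} {e : Fin 4 → TangentSpace (𝓡 4) x}

lemma coord4_self (he : IsOrthonormal4 g x e) (i : Fin 4) :
    coord4 g e (e i) = Pi.single i 1 := by
  ext j
  simp [coord4, he j i, Pi.single_apply]

lemma inner_eq_dot4 (he : IsOrthonormal4 g x e) (v w : TangentSpace (𝓡 4) x) :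
    g.inner x v w = dot4 (coord4 g e v) (coord4 g e w) := by
  rw [he.inner_eq, Fin.sum_univ_four]
  rfl

lemma vol4_eq_det4 (he : IsOrthonormal4 g x e) (o : ManifoldOrientation M)
    (a b c d : TangentSpace (𝓡 4) x) : vol4 o g x ![a, b, c, d] =
      vol4 o g x e * det4 (coord4 g e a) (coord4 g e b) (coord4 g e c) (coord4 g e d) := by
  rw [he.vol4_eq, det4]
  congr 2
  ext i j
  fin_cases i <;> rfl

end IsOrthonormal4

/-- The triple cross product, `⟨cross a b c, d⟩ = vol (a, b, c, d)`. -/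
def cross (o : ManifoldOrientation M) (g : Metric4 M) (x : M) (a b c : TangentSpace (𝓡 4) x) :
    TangentSpace (𝓡 4) x :=
  ∑ i, vol4 o g x ![a, b, c, onBasis g x i] • onBasis g x i

lemma AlternatingMap.sum_apply_vec4 {V : Type*} [AddCommGroup V] [Module ℝ V]
    (φ : V [⋀^Fin 4]→ₗ[ℝ] ℝ) (a b c : V) (t : Fin 4 → ℝ) (e : Fin 4 → V) :
    φ ![a, b, c, ∑ i, t i • e i] = ∑ i, t i * φ ![a, b, c, e i] := by
  have h : ∀ d, Function.update ![a, b, c, 0] 3 d = ![a, b, c, d] := by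
    intro d; ext i; fin_cases i <;> rfl
  have h' : ∀ (r : ℝ) d, φ ![a, b, c, r • d] = r * φ ![a, b, c, d] := by
    intro r d
    rw [← h (r • d), AlternatingMap.map_update_smul, h, smul_eq_mul]
  rw [← h, AlternatingMap.map_update_sum]
  simp only [h, h']

lemma inner_cross (o : ManifoldOrientation M) (g : Metric4 M) (x : M)
    (a b c d : TangentSpace (𝓡 4) x) :
    g.inner x (cross o g x a b c) d = vol4 o g x ![a, b, c, d] := by
  conv_rhs => rw [← (isOrthonormal4_onBasis g x).sum_smul d, AlternatingMap.sum_apply_vec4]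
  simp [cross, mul_comm]

/-- The difference of a Weyl connection and a connection with skew torsion, as a trilinear map. -/
def weylTensor (o : ManifoldOrientation M) (g : Metric4 M) (x : M)
    (a b c : TangentSpace (𝓡 4) x) : TangentSpace (𝓡 4) x :=
  (1 / 2 : ℝ) • (cross o g x a b c - g.inner x a b • c - g.inner x a c • b + g.inner x b c • a)

lemma inner_weylTensor (o : ManifoldOrientation M) (g : Metric4 M) (x : M)
    (a b c d : TangentSpace (𝓡 4) x) :
    g.inner x (weylTensor o g x a b c) d = (vol4 o g x ![a, b, c, d]
      - g.inner x a b * g.inner x c d - g.inner x a c * g.inner x b d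
      + g.inner x b c * g.inner x a d) / 2 := by
  simp only [weylTensor, map_smul, map_add, map_sub, add_apply, sub_apply, smul_apply,
    inner_cross, smul_eq_mul]
  simp
  ring

namespace IsOrthonormal4

variable {g : Metric4 M} {x : M} {e : Fin 4 → TangentSpace (𝓡 4) x}

lemma coord4_cross (he : IsOrthonormal4 g x e) (o : ManifoldOrientation M)
    (a b c : TangentSpace (𝓡 4) x) : coord4 g e (cross o g x a b c) =
      vol4 o g x e • cross4 (coord4 g e a) (coord4 g e b) (coord4 g e c) := by
  ext i
  rw [coord4, g.symm, inner_cross, he.vol4_eq_det4, he.coord4_self]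
  rfl

lemma coord4_weylTensor (he : IsOrthonormal4 g x e) (o : ManifoldOrientation M)
    (a b c : TangentSpace (𝓡 4) x) : coord4 g e (weylTensor o g x a b c) =
      weyl4 (vol4 o g x e) (coord4 g e a) (coord4 g e b) (coord4 g e c) := by
  simp only [weylTensor, coord4_smul, coord4_add, coord4_sub, he.coord4_cross, he.inner_eq_dot4]
  ext i
  simp [weyl4]
  ring

end IsOrthonormal4

/-- In the application `a` is `ξ`, `L` is `Nξ` and `Q` is the difference of the two curvatures. In
coordinates the trace splits into a part linear in `L`, handled by `weyl4_trace_linear`, and a part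
quadratic in `a`, which symmetrization kills by `weyl4_trace_quadratic`. -/
lemma weylTensor_trace (o : ManifoldOrientation M) (g : Metric4 M) (x : M)
    (a : TangentSpace (𝓡 4) x) (L : TangentSpace (𝓡 4) x →ₗ[ℝ] TangentSpace (𝓡 4) x)
    {e : Fin 4 → TangentSpace (𝓡 4) x} (he : IsOrthonormal4 g x e)
    (Q : TangentSpace (𝓡 4) x → TangentSpace (𝓡 4) x → TangentSpace (𝓡 4) x →
      TangentSpace (𝓡 4) x)
    (hQ : ∀ w u v, Q w u v = weylTensor o g x (L w) u v - weylTensor o g x (L u) w v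
      + weylTensor o g x a (-cross o g x a w u) v + weylTensor o g x a w (weylTensor o g x a u v)
      - weylTensor o g x a u (weylTensor o g x a w v)) (u v : TangentSpace (𝓡 4) x) :
    symPart (fun u v => ∑ i, g.inner x (Q (e i) u v) (e i)) u v =
      symPart (fun u v => g.inner x (L u) v) u v
        + (∑ i, g.inner x (L (e i)) (e i)) / 2 * g.inner x u v := by
  have hL : ∀ w, coord4 g e (L w) = ∑ j, coord4 g e w j • coord4 g e (L (e j)) := by
    intro w
    conv_lhs => rw [← he.sum_smul w]
    ext i
    simp [coord4]
  have h1 := weyl4_trace_linear (vol4 o g x e) (fun j => coord4 g e (L (e j)))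
    (coord4 g e u) (coord4 g e v)
  have h2 := weyl4_trace_quadratic (he.vol4_sq o) (coord4 g e a) (coord4 g e u) (coord4 g e v)
  have key : ∀ u v, ∑ i, g.inner x (Q (e i) u v) (e i) =
      (∑ i, (weyl4 (vol4 o g x e) (coord4 g e (L (e i))) (coord4 g e u) (coord4 g e v) i
        - weyl4 (vol4 o g x e) (coord4 g e (L u)) (Pi.single i 1) (coord4 g e v) i))
      + ∑ i, (weyl4 (vol4 o g x e) (coord4 g e a) (-((vol4 o g x e) • cross4 (coord4 g e a)
          (Pi.single i 1) (coord4 g e u))) (coord4 g e v) i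
        + weyl4 (vol4 o g x e) (coord4 g e a) (Pi.single i 1)
          (weyl4 (vol4 o g x e) (coord4 g e a) (coord4 g e u) (coord4 g e v)) i
        - weyl4 (vol4 o g x e) (coord4 g e a) (coord4 g e u)
          (weyl4 (vol4 o g x e) (coord4 g e a) (Pi.single i 1) (coord4 g e v)) i) := by
    intro u v
    rw [← Finset.sum_add_distrib]
    refine Finset.sum_congr rfl fun i _ => ?_
    rw [g.symm]
    change coord4 g e (Q (e i) u v) i = _
    rw [hQ]
    simp only [coord4_add, coord4_sub, coord4_neg, he.coord4_weylTensor, he.coord4_cross,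
      he.coord4_self, Pi.add_apply, Pi.sub_apply]
    ring
  have h3 : ∑ i, g.inner x (L (e i)) (e i) = ∑ i, coord4 g e (L (e i)) i :=
    Finset.sum_congr rfl fun i _ => g.symm x _ _
  simp only [symPart, key, h3]
  rw [he.inner_eq_dot4 (L u) v, he.inner_eq_dot4 (L v) u, he.inner_eq_dot4 u v]
  simp only [← hL] at h1
  linarith

/-! ### Metric traces -/

lemma metricTrace_eq (g : Metric4 M) (x : M)
    (B : TangentSpace (𝓡 4) x → TangentSpace (𝓡 4) x → ℝ) :
    metricTrace g x B = ∑ i, B (onBasis g x i) (onBasis g x i) := rfl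

/-- The multiple `c` of the metric is pure trace and drops out. The trace of `S` survives as a
correction because `S` enters the right-hand side with its trace. -/
lemma symTraceFree_eq_add (g : Metric4 M) (x : M)
    (B B' S : TangentSpace (𝓡 4) x → TangentSpace (𝓡 4) x → ℝ) (c : ℝ)
    (h : ∀ u v, symPart B u v = symPart B' u v + symPart S u v + c * g.inner x u v)
    (u v : TangentSpace (𝓡 4) x) :
    symTraceFree g x B u v = symTraceFree g x B' u v + symPart S u v
      - metricTrace g x S / 4 * g.inner x u v := by
  have h1 : metricTrace g x (symPart B) =
      metricTrace g x (symPart B') + metricTrace g x S + 4 * c := by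
    have h2 : ∀ i, g.inner x (onBasis g x i) (onBasis g x i) = 1 := fun i => by
      simp [isOrthonormal4_onBasis g x i i]
    simp only [metricTrace_eq, h, h2, Finset.sum_add_distrib]
    simp [symPart]
  simp only [symTraceFree, h, h1]
  ring

/-! ### Hodge stars -/

lemma strictMono_fin_three_iff (I : Fin 3 → Fin 4) : StrictMono I ↔
    I = ![0, 1, 2] ∨ I = ![0, 1, 3] ∨ I = ![0, 2, 3] ∨ I = ![1, 2, 3] := by
  have h : StrictMono I ↔ I 0 < I 1 ∧ I 1 < I 2 := by
    rw [Fin.strictMono_iff_lt_succ, Fin.forall_fin_two]; rfl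
  have h2 : I = ![I 0, I 1, I 2] := by ext i; fin_cases i <;> rfl
  rw [h, h2]
  generalize I 0 = a
  generalize I 1 = b
  generalize I 2 = c
  revert a b c
  decide

lemma sum_strictMono_fin_three (f : (Fin 3 → Fin 4) → ℝ) :
    ∑ I : Fin 3 → Fin 4 with StrictMono I, f I =
      f ![0, 1, 2] + f ![0, 1, 3] + f ![0, 2, 3] + f ![1, 2, 3] := by
  have h : (Finset.univ.filter fun I : Fin 3 → Fin 4 => StrictMono I) =
      {![0, 1, 2], ![0, 1, 3], ![0, 2, 3], ![1, 2, 3]} := by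
    ext I; simp [strictMono_fin_three_iff]
  rw [h, Finset.sum_insert (by decide), Finset.sum_insert (by decide),
    Finset.sum_insert (by decide), Finset.sum_singleton]
  ring

lemma AlternatingMap.finset_sum_apply {V ι κ : Type*} [AddCommGroup V] [Module ℝ V]
    (s : Finset κ) (φ : κ → V [⋀^ι]→ₗ[ℝ] ℝ) (v : ι → V) : (∑ k ∈ s, φ k) v = ∑ k ∈ s, φ k v := by
  classical
  induction s using Finset.induction_on with
  | empty => simp
  | insert a s ha h => simp [Finset.sum_insert ha, h]

lemma star4_one_apply (o : ManifoldOrientation M) (g : Metric4 M)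
    (α : Π x : M, (Fin 1 → TangentSpace (𝓡 4) x) → ℝ) (x : M) (u v w : TangentSpace (𝓡 4) x) :
    star4 o g (k := 1) (m := 3) rfl α x ![u, v, w] =
      ∑ i, α x ![onBasis g x i] * vol4 o g x ![onBasis g x i, u, v, w] := by
  have h : (Finset.univ.filter fun I : Fin 1 → Fin 4 => StrictMono I) = Finset.univ := by
    ext I; simp [Subsingleton.strictMono]
  have h1 : star4 o g (k := 1) (m := 3) rfl α x ![u, v, w] =
      ∑ I : Fin 1 → Fin 4 with StrictMono I, α x (fun j => onBasis g x (I j)) *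
        vol4 o g x (Fin.append (fun j => onBasis g x (I j)) ![u, v, w] ∘ Fin.cast rfl) := by
    simp only [star4, hodgeStar, AlternatingMap.finset_sum_apply, AlternatingMap.smul_apply, smul_eq_mul]
    rfl
  rw [h1, h, ← (Equiv.funUnique (Fin 1) (Fin 4)).symm.sum_comp]
  refine Finset.sum_congr rfl fun i _ => ?_
  congr 2
  · ext j; fin_cases j; rfl
  · ext j; fin_cases j <;> rfl

lemma star4_three_apply (o : ManifoldOrientation M) (g : Metric4 M)
    (α : Π x : M, (Fin 3 → TangentSpace (𝓡 4) x) → ℝ) (x : M) (v : TangentSpace (𝓡 4) x) :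
    star4 o g (k := 3) (m := 1) rfl α x ![v] =
      α x ![onBasis g x 0, onBasis g x 1, onBasis g x 2] *
        vol4 o g x ![onBasis g x 0, onBasis g x 1, onBasis g x 2, v]
      + α x ![onBasis g x 0, onBasis g x 1, onBasis g x 3] *
        vol4 o g x ![onBasis g x 0, onBasis g x 1, onBasis g x 3, v]
      + α x ![onBasis g x 0, onBasis g x 2, onBasis g x 3] *
        vol4 o g x ![onBasis g x 0, onBasis g x 2, onBasis g x 3, v]
      + α x ![onBasis g x 1, onBasis g x 2, onBasis g x 3] *
        vol4 o g x ![onBasis g x 1, onBasis g x 2, onBasis g x 3, v] := by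
  have h1 : star4 o g (k := 3) (m := 1) rfl α x ![v] =
      ∑ I : Fin 3 → Fin 4 with StrictMono I, α x (fun j => onBasis g x (I j)) *
        vol4 o g x (Fin.append (fun j => onBasis g x (I j)) ![v] ∘ Fin.cast rfl) := by
    simp only [star4, hodgeStar, AlternatingMap.finset_sum_apply, AlternatingMap.smul_apply, smul_eq_mul]
    rfl
  rw [h1, sum_strictMono_fin_three]
  congr 1; congr 1; congr 1
  all_goals
    congr 2 <;>
    · ext j; fin_cases j <;> rfl

lemma star4_four_apply (o : ManifoldOrientation M) (g : Metric4 M)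
    (α : Π x : M, (Fin 4 → TangentSpace (𝓡 4) x) → ℝ) (x : M) :
    star4 o g (k := 4) (m := 0) rfl α x ![] = α x (onBasis g x) * vol4 o g x (onBasis g x) := by
  have h1 : star4 o g (k := 4) (m := 0) rfl α x ![] =
      ∑ I : Fin 4 → Fin 4 with StrictMono I, α x (fun j => onBasis g x (I j)) *
        vol4 o g x (Fin.append (fun j => onBasis g x (I j)) ![] ∘ Fin.cast rfl) := by
    simp only [star4, hodgeStar, AlternatingMap.finset_sum_apply, AlternatingMap.smul_apply, smul_eq_mul]
    rfl
  have h : (Finset.univ.filter fun I : Fin 4 → Fin 4 => StrictMono I) = {id} := by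
    ext I
    simp only [Finset.mem_filter, Finset.mem_univ, true_and, Finset.mem_singleton]
    refine ⟨fun hI => ?_, fun hI => hI ▸ strictMono_id⟩
    -- A strictly increasing self-map of a finite chain is bijective, and the order automorphism of
    -- a well-ordered set is unique.
    have := Subsingleton.elim (hI.orderIsoOfSurjective _
      (Finite.injective_iff_surjective.mp hI.injective)) (OrderIso.refl _)
    exact congrArg DFunLike.coe this
  rw [h1, h, Finset.sum_singleton]
  congr 2
  ext j; fin_cases j <;> rfl

/-- The vector field dual to a 1-form. -/
def sharp (g : Metric4 M) (θ : Form4 M 1) (x : M) : TangentSpace (𝓡 4) x :=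
  ∑ i, θ x ![onBasis g x i] • onBasis g x i

lemma form_one_smul_add {V : Type*} [AddCommGroup V] [Module ℝ V] (φ : V [⋀^Fin 1]→ₗ[ℝ] ℝ) :
    ∃ f : V →ₗ[ℝ] ℝ, ∀ v, φ ![v] = f v := by
  have h : ∀ v, Function.update ![(0 : V)] 0 v = ![v] := by
    intro v; ext i; fin_cases i; rfl
  refine ⟨⟨⟨fun v => φ ![v], fun v w => ?_⟩, fun c v => ?_⟩, fun v => rfl⟩
  · rw [← h, AlternatingMap.map_update_add, h, h]
  · simp only [← h (c • v)]
    rw [AlternatingMap.map_update_smul, h]; rfl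

lemma inner_sharp (g : Metric4 M) (θ : Form4 M 1) (x : M) (v : TangentSpace (𝓡 4) x) :
    g.inner x (sharp g θ x) v = θ x ![v] := by
  obtain ⟨f, hf⟩ := form_one_smul_add (θ x)
  rw [hf]
  conv_rhs => rw [← (isOrthonormal4_onBasis g x).sum_smul v]
  simp [sharp, hf, mul_comm]

lemma star4_one_eq (o : ManifoldOrientation M) (g : Metric4 M) (θ : Form4 M 1) (x : M)
    (u v w : TangentSpace (𝓡 4) x) :
    star4 o g (k := 1) (m := 3) rfl (fun x => θ x) x ![u, v, w] =
      vol4 o g x ![sharp g θ x, u, v, w] := by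
  rw [star4_one_apply]
  have h : ∀ d, Function.update ![0, u, v, w] 0 d = ![d, u, v, w] := by
    intro d; ext i; fin_cases i <;> rfl
  have h' : ∀ (r : ℝ) d, vol4 o g x ![r • d, u, v, w] = r * vol4 o g x ![d, u, v, w] := by
    intro r d
    rw [← h (r • d), AlternatingMap.map_update_smul, h, smul_eq_mul]
  rw [sharp, ← h, AlternatingMap.map_update_sum]
  simp only [h, h']

/-- This is `⋆(-⋆a) = a`. Each of the four terms of the star contains the volume of the basis twice,
so its sign disappears, and the cofactors assemble to the inner product. -/
lemma star4_three_of_eq (o : ManifoldOrientation M) (g : Metric4 M) (H : Form4 M 3) (x : M)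
    (a : TangentSpace (𝓡 4) x) (hH : ∀ u v w, H x ![u, v, w] = -vol4 o g x ![a, u, v, w])
    (v : TangentSpace (𝓡 4) x) :
    star4 o g (k := 3) (m := 1) rfl (fun x => H x) x ![v] = g.inner x a v := by
  have he := isOrthonormal4_onBasis g x
  rw [star4_three_apply]
  simp only [hH, he.vol4_eq_det4, he.coord4_self, he.inner_eq_dot4, det4_eq, dot4,
    Pi.single_apply]
  have hs := he.vol4_sq o
  simp
  linear_combination (coord4 g (onBasis g x) a 0 * coord4 g (onBasis g x) v 0 +
    coord4 g (onBasis g x) a 1 * coord4 g (onBasis g x) v 1 +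
    coord4 g (onBasis g x) a 2 * coord4 g (onBasis g x) v 2 +
    coord4 g (onBasis g x) a 3 * coord4 g (onBasis g x) v 3) * hs

lemma AlternatingMap.swap_three {V : Type*} [AddCommGroup V] [Module ℝ V]
    (φ : V [⋀^Fin 3]→ₗ[ℝ] ℝ) (a b c : V) :
    φ ![b, a, c] = -φ ![a, b, c] ∧ φ ![a, c, b] = -φ ![a, b, c] ∧ φ ![c, b, a] = -φ ![a, b, c] := by
  refine ⟨?_, ?_, ?_⟩
  · rw [← φ.map_swap _ (show (0 : Fin 3) ≠ 1 by decide)]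
    congr 1; ext i; fin_cases i <;> rfl
  · rw [← φ.map_swap _ (show (1 : Fin 3) ≠ 2 by decide)]
    congr 1; ext i; fin_cases i <;> rfl
  · rw [← φ.map_swap _ (show (0 : Fin 3) ≠ 2 by decide)]
    congr 1; ext i; fin_cases i <;> rfl

/-- The contraction of the volume form with a vector. -/
def volContract (o : ManifoldOrientation M) (g : Metric4 M) (x : M) (a : TangentSpace (𝓡 4) x) :
    TangentSpace (𝓡 4) x [⋀^Fin 3]→ₗ[ℝ] ℝ :=
  contractForm (k := 1) (m := 3) rfl (vol4 o g x) ![a]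

lemma volContract_apply (o : ManifoldOrientation M) (g : Metric4 M) (x : M)
    (a u v w : TangentSpace (𝓡 4) x) :
    volContract o g x a ![u, v, w] = vol4 o g x ![a, u, v, w] := by
  change vol4 o g x (Fin.append ![a] ![u, v, w] ∘ Fin.cast rfl) = _
  congr 1
  ext j; fin_cases j <;> rfl

/-- The other orderings of each increasing triple of basis vectors only change signs, and they
change both forms in the same way. -/
lemma form_three_ext {g : Metric4 M} {x : M} {e : Fin 4 → TangentSpace (𝓡 4) x}
    (he : IsOrthonormal4 g x e) (φ ψ : TangentSpace (𝓡 4) x [⋀^Fin 3]→ₗ[ℝ] ℝ)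
    (h0 : φ ![e 1, e 2, e 3] = ψ ![e 1, e 2, e 3]) (h1 : φ ![e 0, e 2, e 3] = ψ ![e 0, e 2, e 3])
    (h2 : φ ![e 0, e 1, e 3] = ψ ![e 0, e 1, e 3]) (h3 : φ ![e 0, e 1, e 2] = ψ ![e 0, e 1, e 2]) :
    φ = ψ := by
  have hperm : ∀ a b c, φ ![a, b, c] = ψ ![a, b, c] →
      (φ ![b, a, c] = ψ ![b, a, c]) ∧ (φ ![a, c, b] = ψ ![a, c, b]) ∧
      (φ ![b, c, a] = ψ ![b, c, a]) ∧ (φ ![c, a, b] = ψ ![c, a, b]) ∧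
      (φ ![c, b, a] = ψ ![c, b, a]) := by
    intro a b c h
    have k1 := φ.swap_three a b c
    have k2 := ψ.swap_three a b c
    have k3 := φ.swap_three b a c
    have k4 := ψ.swap_three b a c
    have k5 := φ.swap_three a c b
    have k6 := ψ.swap_three a c b
    refine ⟨?_, ?_, ?_, ?_, ?_⟩ <;> linarith
  let := (⟨g.toRiemannianMetric⟩ : Bundle.RiemannianBundle (fun x : M => TangentSpace (𝓡 4) x))
  obtain ⟨b, rfl⟩ := he.exists_basis
  refine Basis.ext_alternating b.toBasis fun v hv => ?_
  have hv3 : (fun i => b.toBasis (v i)) = ![b (v 0), b (v 1), b (v 2)] := by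
    ext i; fin_cases i <;> simp
  rw [hv3]
  have h01 : v 0 ≠ v 1 := hv.ne (by decide)
  have h02 : v 0 ≠ v 2 := hv.ne (by decide)
  have h12 : v 1 ≠ v 2 := hv.ne (by decide)
  have p0 := hperm _ _ _ h0
  have p1 := hperm _ _ _ h1
  have p2 := hperm _ _ _ h2
  have p3 := hperm _ _ _ h3
  generalize v 0 = i at *
  generalize v 1 = j at *
  generalize v 2 = k at *
  fin_cases i <;> fin_cases j <;> fin_cases k <;> first | exact absurd rfl h01 | exact absurd rfl h02 | exact absurd rfl h12 | skip
  all_goals first | assumption | exact p0.1 | exact p0.2.1 | exact p0.2.2.1 | exact p0.2.2.2.1 | exact p0.2.2.2.2 | exact p1.1 | exact p1.2.1 | exact p1.2.2.1 | exact p1.2.2.2.1 | exact p1.2.2.2.2 | exact p2.1 | exact p2.2.1 | exact p2.2.2.1 | exact p2.2.2.2.1 | exact p2.2.2.2.2 | exact p3.1 | exact p3.2.1 | exact p3.2.2.1 | exact p3.2.2.2.1 | exact p3.2.2.2.2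

/-- In dimension four, `H = -⋆⋆H` for 3-forms. -/
lemma form_three_eq_neg_volContract (o : ManifoldOrientation M) (g : Metric4 M) (H : Form4 M 3)
    (x : M) : H x = -volContract o g x
      (sharp g (star4 o g (k := 3) (m := 1) rfl fun x => H x) x) := by
  have he := isOrthonormal4_onBasis g x
  have hs := he.vol4_sq o
  -- The components of the dual vector are the values of `⋆H` on the basis. On each increasing
  -- triple the claim then becomes `s² = 1` times one component of `H`.
  have hc : ∀ i, coord4 g (onBasis g x)
      (sharp g (star4 o g (k := 3) (m := 1) rfl fun x => H x) x) i =
      star4 o g (k := 3) (m := 1) rfl (fun x => H x) x ![onBasis g x i] := fun i => by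
    rw [coord4, g.symm, inner_sharp]
  apply form_three_ext he <;>
  · rw [AlternatingMap.neg_apply, volContract_apply, he.vol4_eq_det4, he.coord4_self,
      he.coord4_self, he.coord4_self, det4_eq]
    simp only [Pi.single_apply, hc, star4_three_apply, he.vol4_eq_det4, det4_eq, he.coord4_self]
    simp
    generalize H x _ = h at *
    linear_combination (-h) * hs

end
end

/-! ### Calculus of determinants, vector fields and metrics on the manifold. -/

noncomputable section
section
variable {M : Type*} [TopologicalSpace M] [ChartedSpace E4 M]

/-- Differentiability of a function at a point. -/
abbrev FDiffAt (f : M → ℝ) (p : M) : Prop := MDifferentiableAt (𝓡 4) 𝓘(ℝ) f p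

/-- Smoothness of a function on a set. -/
abbrev FSmoothOn (f : M → ℝ) (u : Set M) : Prop := ContMDiffOn (𝓡 4) 𝓘(ℝ) ∞ f u

lemma mvfderiv_congr {f f' : M → ℝ} {p : M} (h : f =ᶠ[𝓝 p] f') :
    mvfderiv (𝓡 4) f p = mvfderiv (𝓡 4) f' p := by
  rw [mvfderiv, mvfderiv, h.mfderiv_eq]
  rfl

/-! ### Determinants -/

lemma contDiff_det4 : ContDiff ℝ ∞ (fun A : Fin 4 → Fin 4 → ℝ => Matrix.det (Matrix.of A)) := by
  simp only [Matrix.det_apply, Matrix.of_apply]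
  fun_prop

lemma hasFDerivAt_det4 (A : Fin 4 → Fin 4 → ℝ) :
    ∃ L : (Fin 4 → Fin 4 → ℝ) →L[ℝ] ℝ,
      HasFDerivAt (fun A : Fin 4 → Fin 4 → ℝ => Matrix.det (Matrix.of A)) L A ∧
      ∀ B, L B = ∑ i, Matrix.det (Matrix.of (Function.update A i (B i))) := by
  -- The determinant is multilinear in the rows, so its derivative is the sum over rows of the
  -- determinants with one row replaced.
  obtain ⟨f, hf⟩ : ∃ f : ContinuousMultilinearMap ℝ (fun _ : Fin 4 => Fin 4 → ℝ) ℝ,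
      ∀ A : Fin 4 → Fin 4 → ℝ, f A = Matrix.det (Matrix.of A) :=
    ⟨⟨(Matrix.detRowAlternating (R := ℝ) (n := Fin 4)).toMultilinearMap, contDiff_det4.continuous⟩,
      fun A => rfl⟩
  have h := f.hasFDerivAt A
  refine ⟨f.linearDeriv A, ?_, fun B => ?_⟩
  · rwa [show (fun A : Fin 4 → Fin 4 → ℝ => Matrix.det (Matrix.of A)) = f from
      funext fun A => (hf A).symm]
  · rw [f.linearDeriv_apply]
    exact Finset.sum_congr rfl fun i _ => hf _

lemma FSmoothOn.det {F : M → Fin 4 → Fin 4 → ℝ} {u : Set M}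
    (hF : ∀ i j, FSmoothOn (fun x => F x i j) u) :
    FSmoothOn (fun x => Matrix.det (Matrix.of (F x))) u := by
  refine contDiff_det4.contMDiff.comp_contMDiffOn (f := F) ?_
  exact contMDiffOn_pi_space.mpr fun i => contMDiffOn_pi_space.mpr fun j => hF i j

lemma mvfderiv_det {F : M → Fin 4 → Fin 4 → ℝ} {p : M} (hF : ∀ i j, FDiffAt (fun x => F x i j) p)
    (v : TangentSpace (𝓡 4) p) :
    FDiffAt (fun x => Matrix.det (Matrix.of (F x))) p ∧
    mvfderiv (𝓡 4) (fun x => Matrix.det (Matrix.of (F x))) p v =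
      ∑ i, Matrix.det (Matrix.of (Function.update (F p) i
        fun j => mvfderiv (𝓡 4) (fun x => F x i j) p v)) := by
  obtain ⟨L, hL, hB⟩ := hasFDerivAt_det4 (F p)
  have hF' : MDifferentiableAt (𝓡 4) 𝓘(ℝ, Fin 4 → Fin 4 → ℝ) F p := by
    -- Expanding in constant elementary matrices reduces differentiability of `F` to that of its
    -- entries.
    have h : F = ∑ i, ∑ j, fun x =>
        F x i j • (Pi.single i (Pi.single j 1) : Fin 4 → Fin 4 → ℝ) := by
      funext x
      ext i j
      simp [Finset.sum_apply, Pi.single_apply, ite_apply]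
    have h2 : ∀ i j, MDifferentiableAt (𝓡 4) 𝓘(ℝ, Fin 4 → Fin 4 → ℝ)
        (fun x => F x i j • (Pi.single i (Pi.single j 1) : Fin 4 → Fin 4 → ℝ)) p :=
      fun i j => (hF i j).smul mdifferentiableAt_const
    rw [h]
    exact MDifferentiableAt.sum fun i _ => MDifferentiableAt.sum fun j _ => h2 i j
  have h := HasMFDerivAt.comp p hL.hasMFDerivAt hF'.hasMFDerivAt
  refine ⟨h.mdifferentiableAt, ?_⟩
  have h1 : mvfderiv (𝓡 4) (fun x => Matrix.det (Matrix.of (F x))) p v =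
      L (mvfderiv (𝓡 4) F p v) := by
    rw [mvfderiv]
    have := h.mfderiv
    change mfderiv (𝓡 4) 𝓘(ℝ) (fun x => Matrix.det (Matrix.of (F x))) p = _ at this
    rw [this]
    rfl
  rw [h1, hB]
  refine Finset.sum_congr rfl fun i _ => ?_
  congr 3
  funext j
  let P : (Fin 4 → Fin 4 → ℝ) →L[ℝ] ℝ :=
    (ContinuousLinearMap.proj (R := ℝ) (φ := fun _ : Fin 4 => ℝ) j).comp
      (ContinuousLinearMap.proj (R := ℝ) (φ := fun _ : Fin 4 => Fin 4 → ℝ) i)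
  have h2 := (HasMFDerivAt.comp p P.hasMFDerivAt hF'.hasMFDerivAt).mfderiv
  change mfderiv (𝓡 4) 𝓘(ℝ) (fun x => F x i j) p = _ at h2
  have h3 : mvfderiv (𝓡 4) (fun x => F x i j) p v = mvfderiv (𝓡 4) F p v i j := by
    rw [mvfderiv, h2]
    rfl
  exact h3.symm

variable [IsManifold (𝓡 4) ∞ M]

/-- Differentiability of a vector field at a point. -/
abbrev VDiffAt (X : VectorField4 M) (p : M) : Prop :=
  MDifferentiableAt (𝓡 4) (𝓡 4).tangent (fun x => (⟨x, X x⟩ : TangentBundle (𝓡 4) M)) p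

/-- Smoothness of a vector field on a set. -/
abbrev VSmoothOn (X : VectorField4 M) (u : Set M) : Prop :=
  ContMDiffOn (𝓡 4) (𝓡 4).tangent ∞ (fun x => (⟨x, X x⟩ : TangentBundle (𝓡 4) M)) u

lemma VSmoothOn.vdiffAt {X : VectorField4 M} {u : Set M} (h : VSmoothOn X u) (hu : IsOpen u) {p : M}
    (hp : p ∈ u) : VDiffAt X p :=
  ((h p hp).contMDiffAt (hu.mem_nhds hp)).mdifferentiableAt (by simp)

lemma vdiffAt_ext4 {p : M} (v : TangentSpace (𝓡 4) p) : VDiffAt (ext4 v) p :=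
  FiberBundle.mdifferentiableAt_extend (𝓡 4) E4 v

lemma ext4_self {p : M} (v : TangentSpace (𝓡 4) p) : ext4 v p = v :=
  FiberBundle.extend_apply_self (F := E4) v

lemma exists_smoothOn_ext4 {p : M} (v : TangentSpace (𝓡 4) p) :
    ∃ u, IsOpen u ∧ p ∈ u ∧ VSmoothOn (ext4 v) u := by
  obtain ⟨s, hs, h⟩ := FiberBundle.exists_contMDiffOn_extend (k := ∞) (𝓡 4) E4 v
  obtain ⟨u, hus, hu, hp⟩ := mem_nhds_iff.mp hs
  exact ⟨u, hu, hp, h.mono hus⟩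

section fields

variable {X Y : VectorField4 M} {f : M → ℝ} {u : Set M} {p : M}

lemma VDiffAt.add (hX : VDiffAt X p) (hY : VDiffAt Y p) : VDiffAt (fun x => X x + Y x) p :=
  mdifferentiableAt_add_section hX hY

lemma VDiffAt.smul (hf : FDiffAt f p) (hX : VDiffAt X p) : VDiffAt (fun x => f x • X x) p :=
  hf.smul_section hX

lemma VDiffAt.sum {ι : Type*} {s : Finset ι} {X : ι → VectorField4 M}
    (hX : ∀ i ∈ s, VDiffAt (X i) p) : VDiffAt (fun x => ∑ i ∈ s, X i x) p :=
  MDifferentiableAt.sum_section hX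

lemma VDiffAt.congr (hX : VDiffAt X p) (h : ∀ᶠ x in 𝓝 p, Y x = X x) : VDiffAt Y p :=
  MDifferentiableAt.congr_of_eventuallyEq hX (h.mono fun x hx => by simp only [hx])

lemma VSmoothOn.add (hX : VSmoothOn X u) (hY : VSmoothOn Y u) : VSmoothOn (fun x => X x + Y x) u :=
  ContMDiffOn.add_section hX hY

lemma VSmoothOn.sub (hX : VSmoothOn X u) (hY : VSmoothOn Y u) : VSmoothOn (fun x => X x - Y x) u :=
  ContMDiffOn.sub_section hX hY

lemma VSmoothOn.smul (hf : FSmoothOn f u) (hX : VSmoothOn X u) : VSmoothOn (fun x => f x • X x) u :=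
  hf.smul_section hX

lemma VSmoothOn.sum {ι : Type*} {s : Finset ι} {X : ι → VectorField4 M}
    (hX : ∀ i ∈ s, VSmoothOn (X i) u) : VSmoothOn (fun x => ∑ i ∈ s, X i x) u :=
  ContMDiffOn.sum_section hX

lemma VSmoothOn.congr (hX : VSmoothOn X u) (h : ∀ x ∈ u, Y x = X x) : VSmoothOn Y u :=
  ContMDiffOn.congr hX fun x hx => by simp only [h x hx]

/-- A vector field which is smooth near every point of a set is smooth on it. -/
lemma VSmoothOn.of_locally (h : ∀ p ∈ u, ∃ w, IsOpen w ∧ p ∈ w ∧ VSmoothOn X (u ∩ w)) :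
    VSmoothOn X u :=
  contMDiffOn_of_locally_contMDiffOn h

lemma Metric4.fdiffAt (g : Metric4 M) (hX : VDiffAt X p) (hY : VDiffAt Y p) :
    FDiffAt (fun x => g.inner x (X x) (Y x)) p := by
  let : Bundle.RiemannianBundle (fun x : M => TangentSpace (𝓡 4) x) := ⟨g.toRiemannianMetric⟩
  have : IsContMDiffRiemannianBundle (𝓡 4) 1 E4 (fun x : M => TangentSpace (𝓡 4) x) :=
    IsContMDiffRiemannianBundle.of_le (n := ∞) (by simp)
  exact MDifferentiableAt.inner_bundle hX hY

lemma Metric4.fsmoothOn (g : Metric4 M) (hX : VSmoothOn X u) (hY : VSmoothOn Y u) :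
    FSmoothOn (fun x => g.inner x (X x) (Y x)) u := by
  let : Bundle.RiemannianBundle (fun x : M => TangentSpace (𝓡 4) x) := ⟨g.toRiemannianMetric⟩
  exact ContMDiffOn.inner_bundle hX hY

end fields

end
end

/-! ### Smooth orthonormal frames and parallelism of the volume form. -/

noncomputable section
section
variable {M : Type*} [TopologicalSpace M] [ChartedSpace E4 M]

lemma FSmoothOn.of_locally {f : M → ℝ} {u : Set M}
    (h : ∀ p ∈ u, ∃ w, IsOpen w ∧ p ∈ w ∧ FSmoothOn f (u ∩ w)) : FSmoothOn f u :=
  contMDiffOn_of_locally_contMDiffOn h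

variable [IsManifold (𝓡 4) ∞ M]

/-- Gram–Schmidt, one field at a time; fields with index at least `k` are left arbitrary.
Prescribing the values at `p` to be an orthonormal basis means that each new field is a unit vector
at `p` after projection, so that near `p` it can be normalized without an argument about linear
independence. -/
lemma exists_orthonormal_fields (g : Metric4 M) (p : M) (k : ℕ) :
    ∃ u, IsOpen u ∧ p ∈ u ∧ ∃ E : Fin 4 → VectorField4 M,
      (∀ i : Fin 4, i.val < k → VSmoothOn (E i) u ∧ E i p = onBasis g p i) ∧
      ∀ x ∈ u, ∀ i j : Fin 4, i.val < k → j.val < k →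
        g.inner x (E i x) (E j x) = if i = j then 1 else 0 := by
  induction k with
  | zero => exact ⟨Set.univ, isOpen_univ, trivial, fun _ _ => 0, by simp, by simp⟩
  | succ k ih =>
    obtain ⟨u, hu, hpu, E, hE, hon⟩ := ih
    by_cases hk : 4 ≤ k
    · exact ⟨u, hu, hpu, E, fun i _ => hE i (by omega),
        fun x hx i j _ _ => hon x hx i j (by omega) (by omega)⟩
    push Not at hk
    let m : Fin 4 := ⟨k, hk⟩
    obtain ⟨u', hu', hpu', hW⟩ := exists_smoothOn_ext4 (onBasis g p m)
    set W := ext4 (onBasis g p m) with hWdef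
    let S : Finset (Fin 4) := Finset.univ.filter fun i => i.val < k
    let V : VectorField4 M := fun x => W x - ∑ i ∈ S, g.inner x (E i x) (W x) • E i x
    have hV : VSmoothOn V (u ∩ u') := by
      refine VSmoothOn.sub (hW.mono Set.inter_subset_right) (VSmoothOn.sum fun i hi => ?_)
      have hi' := (hE i (by simpa [S] using hi)).1.mono (Set.inter_subset_left (t := u'))
      exact VSmoothOn.smul (g.fsmoothOn hi' (hW.mono Set.inter_subset_right)) hi'
    have hVp : V p = onBasis g p m := by
      have h0 : ∀ i ∈ S, g.inner p (E i p) (W p) • E i p = 0 := by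
        intro i hi
        have hi' : i.val < k := by simpa [S] using hi
        have : i ≠ m := by rintro rfl; simp [m] at hi'
        rw [hWdef, ext4_self, (hE i hi').2, isOrthonormal4_onBasis g p i m, if_neg this, zero_smul]
      simp only [V]
      rw [Finset.sum_eq_zero h0, sub_zero, hWdef, ext4_self]
    have hort : ∀ x ∈ u, ∀ i : Fin 4, i.val < k → g.inner x (E i x) (V x) = 0 := by
      intro x hx i hi
      have hiS : i ∈ S := by simpa [S] using hi
      simp only [V, map_sub, map_sum, map_smul, smul_eq_mul]
      rw [Finset.sum_congr rfl fun j hj => by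
        rw [hon x hx i j hi (by simpa [S] using hj)]]
      simp [hiS]
    let f : M → ℝ := fun x => g.inner x (V x) (V x)
    have hf : FSmoothOn f (u ∩ u') := g.fsmoothOn hV hV
    have hfp : f p = 1 := by
      simp only [f, hVp, isOrthonormal4_onBasis g p m m, if_true]
    let w : Set M := (u ∩ u') ∩ f ⁻¹' Set.Ioi 0
    have hw : IsOpen w := hf.continuousOn.isOpen_inter_preimage (hu.inter hu') isOpen_Ioi
    have hr : FSmoothOn (fun x => (√(f x))⁻¹) w := by
      intro x hx
      have hx0 : 0 < f x := hx.2
      have h1 : ContDiffAt ℝ ∞ (fun t : ℝ => (√t)⁻¹) (f x) :=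
        (Real.contDiffAt_sqrt hx0.ne').inv (Real.sqrt_pos.mpr hx0).ne'
      exact h1.comp_contMDiffWithinAt (hf.mono Set.inter_subset_left x hx)
    refine ⟨w, hw, ⟨⟨hpu, hpu'⟩, by simp [hfp]⟩,
      fun i => if i.val < k then E i else fun x => (√(f x))⁻¹ • V x, fun i hi => ?_, ?_⟩
    · by_cases hik : i.val < k
      · simp only [hik, if_true]
        exact ⟨(hE i hik).1.mono fun x hx => hx.1.1, (hE i hik).2⟩
      · simp only [hik, if_false]
        refine ⟨VSmoothOn.smul hr (hV.mono Set.inter_subset_left), ?_⟩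
        have : i = m := Fin.ext (by simp [m]; omega)
        rw [hfp, hVp, this]; simp
    · intro x hx i j hi hj
      have hx0 : 0 < f x := hx.2
      have hs : √(f x) * √(f x) = f x := Real.mul_self_sqrt hx0.le
      have hs0 : √(f x) ≠ 0 := (Real.sqrt_pos.mpr hx0).ne'
      by_cases hik : i.val < k <;> by_cases hjk : j.val < k
      · simp only [hik, hjk, if_true]
        exact hon x hx.1.1 i j hik hjk
      · have hij : i ≠ j := by rintro rfl; exact hjk hik
        simp only [hik, hjk, if_true, if_false, map_smul, smul_eq_mul, hort x hx.1.1 i hik, mul_zero,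
          if_neg hij]
      · have hij : i ≠ j := by rintro rfl; exact hik hjk
        rw [g.symm]
        simp only [hik, hjk, if_true, if_false, map_smul, smul_eq_mul, hort x hx.1.1 j hjk, mul_zero,
          if_neg hij]
      · have hij : i = j := Fin.ext (by omega)
        subst hij
        simp only [hik, if_false, if_true, map_smul, smul_apply, smul_eq_mul]
        change (√(f x))⁻¹ * ((√(f x))⁻¹ * f x) = 1
        rw [← mul_assoc, ← mul_inv, hs, inv_mul_cancel₀ hx0.ne']

/-- Near every point there is a smooth orthonormal frame on which the volume form is constant. -/
lemma exists_orthonormal_frame (o : ManifoldOrientation M) (g : Metric4 M) (p : M) :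
    ∃ u, IsOpen u ∧ p ∈ u ∧ ∃ E : Fin 4 → VectorField4 M, (∀ i, VSmoothOn (E i) u) ∧
      (∀ x ∈ u, IsOrthonormal4 g x fun i => E i x) ∧
      ∀ x ∈ u, vol4 o g x (fun i => E i x) = vol4 o g p (fun i => E i p) := by
  obtain ⟨u, hu, hpu, E, hE, hon⟩ := exists_orthonormal_fields g p 4
  have hE' : ∀ i, VSmoothOn (E i) u := fun i => (hE i i.isLt).1
  have hon' : ∀ x ∈ u, IsOrthonormal4 g x fun i => E i x :=
    fun x hx i j => hon x hx i j i.isLt j.isLt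
  obtain ⟨u₁, hu₁, s, hs, hso⟩ := o.locally_frame p
  obtain ⟨u', hu'u, hu', hpu'⟩ := mem_nhds_iff.mp hu₁
  have hsm : ∀ i, VSmoothOn (s i) (u ∩ u') := fun i =>
    (hs.contMDiffOn i).mono (Set.inter_subset_right.trans hu'u)
  let d : M → ℝ := fun x => Matrix.det (Matrix.of fun i j => g.inner x (E j x) (s i x))
  have hd : FSmoothOn d (u ∩ u') := FSmoothOn.det (F := fun x i j => g.inner x (E j x) (s i x))
    fun i j => g.fsmoothOn ((hE' j).mono Set.inter_subset_left) (hsm i)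
  have hpos : ∀ x ∈ u ∩ u', 0 < vol4 o g x (fun i => E i x) * d x := by
    intro x hx
    have h1 := vol4_pos_of_orientation o g _ (hso x (hu'u hx.2))
    rw [(hon' x hx.1).vol4_eq] at h1
    convert h1 using 4
    ext i j
    simp
  -- The product of the sign `vol(E)` and `d` is positive, so the two signs agree at each point.
  -- Since `d` is continuous, its sign is that of `d p` near `p`.
  let w : Set M := (u ∩ u') ∩ d ⁻¹' {y | 0 < y * d p}
  have hw : IsOpen w := hd.continuousOn.isOpen_inter_preimage (hu.inter hu')
    (isOpen_lt continuous_const (by fun_prop))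
  have hdp : 0 < d p * d p := by
    have := hpos p ⟨hpu, hpu'⟩
    have h0 : d p ≠ 0 := by rintro h; simp [h] at this
    exact mul_self_pos.mpr h0
  refine ⟨w, hw, ⟨⟨hpu, hpu'⟩, hdp⟩, E, fun i => (hE' i).mono fun x hx => hx.1.1,
    fun x hx => hon' x hx.1.1, fun x hx => ?_⟩
  have h1 := hpos x hx.1
  have h2 := hpos p ⟨hpu, hpu'⟩
  have h3 : 0 < d x * d p := hx.2
  have h4 := (hon' x hx.1.1).vol4_sq o
  have h5 := (hon' p hpu).vol4_sq o
  rcases mul_self_eq_one_iff.mp h4 with h | h <;> rcases mul_self_eq_one_iff.mp h5 with h' | h' <;>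
    rw [h, h'] <;> rw [h] at h1 <;> rw [h'] at h2 <;> nlinarith

lemma vsmoothOn_of_inner (g : Metric4 M) {u : Set M} {E : Fin 4 → VectorField4 M}
    (hE : ∀ i, VSmoothOn (E i) u) (hon : ∀ x ∈ u, IsOrthonormal4 g x fun i => E i x)
    {X : VectorField4 M} (h : ∀ i, FSmoothOn (fun x => g.inner x (E i x) (X x)) u) :
    VSmoothOn X u :=
  VSmoothOn.congr (VSmoothOn.sum (s := Finset.univ) fun i _ => VSmoothOn.smul (h i) (hE i))
    fun x hx => ((hon x hx).sum_smul (X x)).symm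

lemma vdiffAt_of_inner (g : Metric4 M) {u : Set M} (hu : IsOpen u) {p : M} (hp : p ∈ u)
    {E : Fin 4 → VectorField4 M}
    (hE : ∀ i, VSmoothOn (E i) u) (hon : ∀ x ∈ u, IsOrthonormal4 g x fun i => E i x)
    {X : VectorField4 M} (h : ∀ i, FDiffAt (fun x => g.inner x (E i x) (X x)) p) :
    VDiffAt X p :=
  VDiffAt.congr (VDiffAt.sum (s := Finset.univ) fun i _ =>
    VDiffAt.smul (h i) ((hE i).vdiffAt hu hp))
    (Filter.eventually_of_mem (hu.mem_nhds hp) fun x hx => ((hon x hx).sum_smul (X x)).symm)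

/-- The orientation is given pointwise. In a frame on which the volume is constant, the function is
a constant times a determinant of inner products. -/
lemma vol4_fsmoothOn (o : ManifoldOrientation M) (g : Metric4 M) {u : Set M}
    {X : Fin 4 → VectorField4 M} (hX : ∀ i, VSmoothOn (X i) u) :
    FSmoothOn (fun x => vol4 o g x (fun i => X i x)) u := by
  refine FSmoothOn.of_locally fun p hp => ?_
  obtain ⟨w, hw, hpw, E, hE, hon, hv⟩ := exists_orthonormal_frame o g p
  refine ⟨w, hw, hpw, ?_⟩
  have hd : FSmoothOn (fun x => Matrix.det (Matrix.of fun i j => g.inner x (E j x) (X i x)))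
      (u ∩ w) := FSmoothOn.det (F := fun x i j => g.inner x (E j x) (X i x))
    fun i j => g.fsmoothOn ((hE j).mono Set.inter_subset_right)
      ((hX i).mono Set.inter_subset_left)
  have hc : ContDiff ℝ ∞ fun t : ℝ => vol4 o g p (fun i => E i p) * t := by fun_prop
  refine (hc.contMDiff.comp_contMDiffOn hd).congr fun x hx => ?_
  rw [(hon x hx.2).vol4_eq, hv x hx.2]
  rfl

lemma inner_deriv {D : Connection4 M} {g : Metric4 M} (hD : HasMetricDeriv D g 0) {p : M}
    {X Y : VectorField4 M} (hX : VDiffAt X p) (hY : VDiffAt Y p) (v : TangentSpace (𝓡 4) p) :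
    mvfderiv (𝓡 4) (fun x => g.inner x (X x) (Y x)) p v =
      g.inner p (D X p v) (Y p) + g.inner p (X p) (D Y p v) := by
  have := hD p X Y hX hY v
  simp [covDerivMetric] at this
  linarith

/-- The sum is the derivative of `det` at `F` in the direction `F G`, that is `det F * tr G`, and a
skew matrix has trace zero. -/
lemma det_update_sum_mul (F G : Fin 4 → Fin 4 → ℝ) (hG : ∀ i j, G i j = -G j i) :
    ∑ i, Matrix.det (Matrix.of (Function.update F i fun j => ∑ k, F i k * G k j)) = 0 := by
  have hd : ∀ A : Fin 4 → Fin 4 → ℝ, Matrix.det (Matrix.of A) = det4 (A 0) (A 1) (A 2) (A 3) := by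
    intro A
    rw [det4]
    congr 2
    ext i j
    fin_cases i <;> rfl
  have h0 : ∀ i, G i i = 0 := fun i => by have := hG i i; linarith
  have h1 : det4 (F 0) (F 1) (F 2) (F 3) * (G 0 0 + G 1 1 + G 2 2 + G 3 3) = 0 := by simp [h0]
  rw [det4_eq] at h1
  simp only [hd, det4_eq, Fin.sum_univ_four]
  simp
  linear_combination h1

/-- The volume form is parallel for metric connections. -/
lemma vol4_deriv (o : ManifoldOrientation M) {D : Connection4 M} {g : Metric4 M}
    (hD : HasMetricDeriv D g 0) {p : M} {X : Fin 4 → VectorField4 M} (hX : ∀ i, VDiffAt (X i) p)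
    (v : TangentSpace (𝓡 4) p) :
    FDiffAt (fun x => vol4 o g x (fun i => X i x)) p ∧
    mvfderiv (𝓡 4) (fun x => vol4 o g x (fun i => X i x)) p v =
      ∑ i, vol4 o g p (Function.update (fun i => X i p) i (D (X i) p v)) := by
  obtain ⟨u, hu, hpu, E, hE, hon, hv⟩ := exists_orthonormal_frame o g p
  have hEp : ∀ i, VDiffAt (E i) p := fun i => (hE i).vdiffAt hu hpu
  set c := vol4 o g p (fun i => E i p)
  let F : M → Fin 4 → Fin 4 → ℝ := fun x i j => g.inner x (E j x) (X i x)
  have hF : ∀ i j, FDiffAt (fun x => F x i j) p := fun i j => g.fdiffAt (hEp j) (hX i)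
  have hev : (fun x => vol4 o g x (fun i => X i x)) =ᶠ[𝓝 p]
      fun x => c * Matrix.det (Matrix.of (F x)) := by
    filter_upwards [hu.mem_nhds hpu] with x hx
    rw [(hon x hx).vol4_eq, hv x hx]
  obtain ⟨h1, h2⟩ := mvfderiv_det hF v
  refine ⟨(MDifferentiableAt.congr_of_eventuallyEq (mdifferentiableAt_const.smul h1) hev), ?_⟩
  rw [mvfderiv_congr hev, mvfderiv_fun_mul mdifferentiableAt_const h1]
  -- The connection matrix in an orthonormal frame is skew. It contributes the trace term of
  -- `det_update_sum_mul`, which vanishes, so only the derivatives of the `X i` remain.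
  have hEE : ∀ i j, g.inner p (D (E i) p v) (E j p) = -g.inner p (D (E j) p v) (E i p) := by
    intro i j
    have h3 := inner_deriv hD (hEp i) (hEp j) v
    have h4 : (fun x => g.inner x (E i x) (E j x)) =ᶠ[𝓝 p] fun _ => if i = j then 1 else 0 := by
      filter_upwards [hu.mem_nhds hpu] with x hx using hon x hx i j
    rw [mvfderiv_congr h4, mvfderiv_const, g.symm p (E i p)] at h3
    simp at h3
    linarith
  have hder : ∀ i j, mvfderiv (𝓡 4) (fun x => F x i j) p v =
      g.inner p (E j p) (D (X i) p v) + ∑ k, F p i k * g.inner p (D (E j) p v) (E k p) := by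
    intro i j
    rw [inner_deriv hD (hEp j) (hX i), (hon p hpu).inner_eq (D (E j) p v) (X i p), add_comm]
    congr 1
    refine Finset.sum_congr rfl fun k _ => ?_
    rw [mul_comm, g.symm p (E k p) (D (E j) p v)]
  have hdet : ∀ i, Matrix.det (Matrix.of (Function.update (F p) i
      fun j => mvfderiv (𝓡 4) (fun x => F x i j) p v)) =
      Matrix.det (Matrix.of (Function.update (F p) i fun j => g.inner p (E j p) (D (X i) p v))) +
      Matrix.det (Matrix.of (Function.update (F p) i
        fun j => ∑ k, F p i k * g.inner p (D (E j) p v) (E k p))) := by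
    intro i
    rw [show (fun j => mvfderiv (𝓡 4) (fun x => F x i j) p v) =
      (fun j => g.inner p (E j p) (D (X i) p v)) +
      fun j => ∑ k, F p i k * g.inner p (D (E j) p v) (E k p) from funext fun j => hder i j]
    exact Matrix.det_updateRow_add (Matrix.of (F p)) i _ _
  have hskew := det_update_sum_mul (F p) (fun k j => g.inner p (D (E j) p v) (E k p))
    fun i j => hEE j i
  simp only [hdet] at h2
  rw [Finset.sum_add_distrib, hskew, add_zero] at h2
  have h5 : (c • mvfderiv (𝓡 4) (fun x => Matrix.det (Matrix.of (F x))) p) v =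
      c * mvfderiv (𝓡 4) (fun x => Matrix.det (Matrix.of (F x))) p v := rfl
  rw [mvfderiv_const, smul_zero, add_zero, h5, h2, Finset.mul_sum]
  refine Finset.sum_congr rfl fun i _ => ?_
  rw [(hon p hpu).vol4_eq]
  congr 2
  ext k j
  by_cases hk : k = i
  · subst hk; simp
  · simp [hk, F]

end
end

/-! ### Smooth connections, the parallel difference tensor, and uniqueness. -/

noncomputable section
section
variable {M : Type*} [TopologicalSpace M] [ChartedSpace E4 M]

/-- `f` is differentiable at `p` with derivative `c` in direction `v`. -/
def HasDirDeriv (f : M → ℝ) (p : M) (v : TangentSpace (𝓡 4) p) (c : ℝ) : Prop :=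
  FDiffAt f p ∧ mvfderiv (𝓡 4) f p v = c

section HasDirDeriv

variable {f f' : M → ℝ} {p : M} {v : TangentSpace (𝓡 4) p} {c c' : ℝ}

lemma HasDirDeriv.const (r : ℝ) : HasDirDeriv (fun _ => r) p v 0 :=
  ⟨mdifferentiableAt_const, by rw [mvfderiv_const]; rfl⟩

lemma HasDirDeriv.add (h : HasDirDeriv f p v c) (h' : HasDirDeriv f' p v c') :
    HasDirDeriv (fun x => f x + f' x) p v (c + c') :=
  ⟨MDifferentiableAt.add h.1 h'.1, by rw [mvfderiv_fun_add h.1 h'.1, ← h.2, ← h'.2]; rfl⟩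

lemma HasDirDeriv.sub (h : HasDirDeriv f p v c) (h' : HasDirDeriv f' p v c') :
    HasDirDeriv (fun x => f x - f' x) p v (c - c') :=
  ⟨MDifferentiableAt.sub h.1 h'.1, by rw [mvfderiv_fun_sub h.1 h'.1, ← h.2, ← h'.2]; rfl⟩

lemma HasDirDeriv.mul (h : HasDirDeriv f p v c) (h' : HasDirDeriv f' p v c') :
    HasDirDeriv (fun x => f x * f' x) p v (f p * c' + f' p * c) :=
  ⟨MDifferentiableAt.smul h.1 h'.1, by rw [mvfderiv_fun_mul h.1 h'.1, ← h.2, ← h'.2]; rfl⟩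

lemma HasDirDeriv.congr_deriv (h : HasDirDeriv f p v c) (hc : c = c') : HasDirDeriv f p v c' :=
  hc ▸ h

end HasDirDeriv

variable [IsManifold (𝓡 4) ∞ M]

/-! ### Smooth endomorphism fields and smooth connections -/

/-- A trivialization near `x₀` gives a local frame of fields which are constant in it. There the
endomorphism is the sum of the coordinate functionals times its values on the frame, and these are
smooth by assumption. -/
lemma contMDiffOn_endomorphism
    (T : Π x : M, TangentSpace (𝓡 4) x →L[ℝ] TangentSpace (𝓡 4) x) {u : Set M}
    (h : ∀ (w : Set M) (X : VectorField4 M), IsOpen w → VSmoothOn X w →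
      VSmoothOn (fun x => T x (X x)) (u ∩ w)) :
    ContMDiffOn (𝓡 4) ((𝓡 4).prod 𝓘(ℝ, E4 →L[ℝ] E4)) ∞ (fun x =>
      (⟨x, T x⟩ : Bundle.TotalSpace (E4 →L[ℝ] E4)
        fun x : M => TangentSpace (𝓡 4) x →L[ℝ] TangentSpace (𝓡 4) x)) u := by
  intro x₀ hx₀
  rw [contMDiffWithinAt_hom_bundle]
  refine ⟨contMDiffWithinAt_id, ?_⟩
  let t := trivializationAt E4 (fun x : M => TangentSpace (𝓡 4) x) x₀
  have ht : x₀ ∈ t.baseSet := FiberBundle.mem_baseSet_trivializationAt' x₀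
  let b : Fin 4 → E4 := fun i => EuclideanSpace.single i 1
  let X : Fin 4 → VectorField4 M := fun i => ext4 (t.symm x₀ (b i))
  have hX : ∀ i x, x ∈ t.baseSet → X i x = t.symm x (b i) := by
    intro i x hx
    change t.symm x (t ⟨x₀, t.symm x₀ (b i)⟩).2 = _
    rw [t.apply_mk_symm ht]
  have hTX : ∀ i, ContMDiffWithinAt (𝓡 4) 𝓘(ℝ, E4) ∞ (fun x => (t ⟨x, T x (X i x)⟩).2) u x₀ := by
    intro i
    obtain ⟨w, hw, hpw, hXw⟩ := exists_smoothOn_ext4 (t.symm x₀ (b i))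
    have h1 := (h w (X i) hw hXw x₀ ⟨hx₀, hpw⟩).mono_of_mem_nhdsWithin (t := u)
      (inter_mem_nhdsWithin u (hw.mem_nhds hpw))
    exact (Bundle.contMDiffWithinAt_totalSpace.mp h1).2
  have hsum : ContMDiffWithinAt (𝓡 4) 𝓘(ℝ, E4 →L[ℝ] E4) ∞ (fun x => ∑ i : Fin 4,
      (ContinuousLinearMap.smulRightL ℝ E4 E4 (EuclideanSpace.proj i) :
        E4 →L[ℝ] (E4 →L[ℝ] E4)) ((t ⟨x, T x (X i x)⟩).2)) u x₀ := by
    refine contMDiffWithinAt_finsetSum fun i _ => ?_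
    exact (ContinuousLinearMap.contMDiff _).contMDiffAt.comp_contMDiffWithinAt x₀ (hTX i)
  refine hsum.congr_of_eventuallyEq_of_mem ?_ hx₀
  filter_upwards [mem_nhdsWithin_of_mem_nhds (t.open_baseSet.mem_nhds ht)] with x hx
  ext1 v
  have hv : v = ∑ i, v i • b i := by
    ext j
    simp [b, Finset.sum_apply, Pi.single_apply]
  simp only [sum_apply]
  conv_lhs => rw [hv]
  rw [map_sum]
  refine Finset.sum_congr rfl fun i _ => ?_
  rw [map_smul]
  change _ = (v i) • (t ⟨x, T x (X i x)⟩).2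
  congr 1
  rw [ContinuousLinearMap.inCoordinates_eq hx hx, hX i x hx]
  rfl

/-- Replaces smoothness in the bundle of endomorphisms by a test on pairs of vector fields, which is
easy to check when a tensor is added to a connection. -/
lemma isSmoothConnection_iff (D : Connection4 M) : IsSmoothConnection D ↔
    ∀ (u : Set M) (X Y : VectorField4 M), IsOpen u → VSmoothOn X u → VSmoothOn Y u →
      VSmoothOn (fun x => D Y x (X x)) u := by
  constructor
  · intro h u X Y hu hX hY
    exact ((h u hu).contMDiff hY).clm_bundle_apply hX
  · intro h u hu
    refine ⟨fun {σ} hσ => contMDiffOn_endomorphism (fun x => D σ x) fun w X hw hX => ?_⟩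
    exact h _ X σ (hu.inter hw) (hX.mono Set.inter_subset_right)
      (ContMDiffOn.mono hσ Set.inter_subset_left)

/-! ### The difference tensor as a field -/

lemma cross_vsmoothOn (o : ManifoldOrientation M) (g : Metric4 M) {u : Set M}
    {X Y Z : VectorField4 M} (hX : VSmoothOn X u) (hY : VSmoothOn Y u) (hZ : VSmoothOn Z u) :
    VSmoothOn (fun x => cross o g x (X x) (Y x) (Z x)) u := by
  refine VSmoothOn.of_locally fun p hp => ?_
  obtain ⟨w, hw, hpw, E, hE, hon, -⟩ := exists_orthonormal_frame o g p
  refine ⟨w, hw, hpw, vsmoothOn_of_inner g (fun i => (hE i).mono Set.inter_subset_right)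
    (fun x hx => hon x hx.2) fun i => ?_⟩
  have h1 : FSmoothOn (fun x => vol4 o g x (fun j => (![X, Y, Z, E i] : Fin 4 → VectorField4 M) j x))
      (u ∩ w) := by
    refine vol4_fsmoothOn o g fun j => ?_
    fin_cases j
    · exact hX.mono Set.inter_subset_left
    · exact hY.mono Set.inter_subset_left
    · exact hZ.mono Set.inter_subset_left
    · exact (hE i).mono Set.inter_subset_right
  refine h1.congr fun x _ => ?_
  rw [g.symm, inner_cross]
  congr 1
  ext j; fin_cases j <;> rfl

lemma weylTensor_vsmoothOn (o : ManifoldOrientation M) (g : Metric4 M) {u : Set M}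
    {X Y Z : VectorField4 M} (hX : VSmoothOn X u) (hY : VSmoothOn Y u) (hZ : VSmoothOn Z u) :
    VSmoothOn (fun x => weylTensor o g x (X x) (Y x) (Z x)) u :=
  VSmoothOn.smul contMDiffOn_const <| VSmoothOn.add (VSmoothOn.sub (VSmoothOn.sub
    (cross_vsmoothOn o g hX hY hZ) (VSmoothOn.smul (g.fsmoothOn hX hY) hZ))
    (VSmoothOn.smul (g.fsmoothOn hX hZ) hY)) (VSmoothOn.smul (g.fsmoothOn hY hZ) hX)

lemma vol4_vec_deriv (o : ManifoldOrientation M) {D : Connection4 M} {g : Metric4 M}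
    (hD : HasMetricDeriv D g 0) {p : M} {X Y Z W : VectorField4 M} (hX : VDiffAt X p)
    (hY : VDiffAt Y p) (hZ : VDiffAt Z p) (hW : VDiffAt W p) (v : TangentSpace (𝓡 4) p) :
    HasDirDeriv (fun x => vol4 o g x ![X x, Y x, Z x, W x]) p v
      (vol4 o g p ![D X p v, Y p, Z p, W p] + vol4 o g p ![X p, D Y p v, Z p, W p]
      + vol4 o g p ![X p, Y p, D Z p v, W p] + vol4 o g p ![X p, Y p, Z p, D W p v]) := by
  have h := vol4_deriv o hD (X := ![X, Y, Z, W]) (p := p)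
    (by intro i; fin_cases i; exacts [hX, hY, hZ, hW]) v
  have h1 : ∀ x, (fun i => (![X, Y, Z, W] : Fin 4 → VectorField4 M) i x) =
      ![X x, Y x, Z x, W x] := by
    intro x; ext i; fin_cases i <;> rfl
  simp only [h1, Fin.sum_univ_four] at h
  refine ⟨h.1, h.2.trans ?_⟩
  congr 1; congr 1; congr 1
  all_goals congr 1; ext i; fin_cases i <;> rfl

/-- The tensor `weylTensor` is parallel for metric connections. -/
lemma weylTensor_deriv (o : ManifoldOrientation M) {D : Connection4 M} {g : Metric4 M}
    (hD : HasMetricDeriv D g 0) {p : M} {X Y Z : VectorField4 M} (hX : VDiffAt X p)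
    (hY : VDiffAt Y p) (hZ : VDiffAt Z p) (v : TangentSpace (𝓡 4) p) :
    VDiffAt (fun x => weylTensor o g x (X x) (Y x) (Z x)) p ∧
    D (fun x => weylTensor o g x (X x) (Y x) (Z x)) p v =
      weylTensor o g p (D X p v) (Y p) (Z p) + weylTensor o g p (X p) (D Y p v) (Z p)
      + weylTensor o g p (X p) (Y p) (D Z p v) := by
  -- Paired with a fourth field the tensor becomes a polynomial in `vol` and `g`, both parallel, so
  -- the product rule applies. Frame fields `W` then give differentiability, and arbitrary extended
  -- vectors give the derivative itself.
  have hinner : ∀ W : VectorField4 M, VDiffAt W p →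
      HasDirDeriv (fun x => g.inner x (weylTensor o g x (X x) (Y x) (Z x)) (W x)) p v
        (g.inner p (weylTensor o g p (D X p v) (Y p) (Z p)) (W p)
        + g.inner p (weylTensor o g p (X p) (D Y p v) (Z p)) (W p)
        + g.inner p (weylTensor o g p (X p) (Y p) (D Z p v)) (W p)
        + g.inner p (weylTensor o g p (X p) (Y p) (Z p)) (D W p v)) := by
    intro W hW
    have hG : ∀ {A B : VectorField4 M}, VDiffAt A p → VDiffAt B p → HasDirDeriv
        (fun x => g.inner x (A x) (B x)) p v
        (g.inner p (D A p v) (B p) + g.inner p (A p) (D B p v)) :=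
      fun hA hB => ⟨g.fdiffAt hA hB, inner_deriv hD hA hB v⟩
    have hfun : (fun x => g.inner x (weylTensor o g x (X x) (Y x) (Z x)) (W x)) =
        fun x => (1 / 2 : ℝ) * (vol4 o g x ![X x, Y x, Z x, W x]
          - g.inner x (X x) (Y x) * g.inner x (Z x) (W x)
          - g.inner x (X x) (Z x) * g.inner x (Y x) (W x)
          + g.inner x (Y x) (Z x) * g.inner x (X x) (W x)) := by
      funext x
      rw [inner_weylTensor]
      ring
    rw [hfun]
    refine ((HasDirDeriv.const (1 / 2)).mul ((((vol4_vec_deriv o hD hX hY hZ hW v).sub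
      ((hG hX hY).mul (hG hZ hW))).sub ((hG hX hZ).mul (hG hY hW))).add
      ((hG hY hZ).mul (hG hX hW)))).congr_deriv ?_
    simp only [inner_weylTensor]
    ring
  have hdiff : VDiffAt (fun x => weylTensor o g x (X x) (Y x) (Z x)) p := by
    obtain ⟨u, hu, hpu, E, hE, hon, -⟩ := exists_orthonormal_frame o g p
    refine vdiffAt_of_inner g hu hpu hE hon fun i => ?_
    have := (hinner (E i) ((hE i).vdiffAt hu hpu)).1
    simpa only [g.symm _ (E i _)] using this
  refine ⟨hdiff, g.ext_inner fun z => ?_⟩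
  have h1 := (hinner (ext4 z) (vdiffAt_ext4 z)).2
  have h2 := inner_deriv hD hdiff (vdiffAt_ext4 z) v
  rw [h1] at h2
  simp only [ext4_self] at h2
  simp only [map_add, add_apply]
  linarith

/-! ### Comparison of connections -/

lemma mlieBracket_eq (D : Connection4 M) {p : M} {X Y : VectorField4 M} (hX : VDiffAt X p)
    (hY : VDiffAt Y p) : VectorField.mlieBracket (𝓡 4) X Y p =
      D Y p (X p) - D X p (Y p) - D.torsion p (X p) (Y p) := by
  rw [D.torsion_apply hX hY]
  abel

lemma difference_eq (D D' : Connection4 M) :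
    ∃ A : Π x : M, TangentSpace (𝓡 4) x →L[ℝ] TangentSpace (𝓡 4) x →L[ℝ] TangentSpace (𝓡 4) x,
      ∀ (p : M) (X : VectorField4 M), VDiffAt X p → D X p - D' X p = A p (X p) :=
  ⟨fun x => D.isCovariantDerivativeOnUniv.difference D'.isCovariantDerivativeOnUniv x,
    fun _ _ hX => (D.isCovariantDerivativeOnUniv.difference_apply D'.isCovariantDerivativeOnUniv
      (by trivial) hX).symm⟩

/-- A connection is determined by its torsion and the covariant derivative of a metric. -/
lemma connection_unique {g : Metric4 M} {θ : Form4 M 1} {D D' : Connection4 M}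
    (hT : ∀ (p : M) (u v : TangentSpace (𝓡 4) p), D.torsion p u v = D'.torsion p u v)
    (hD : HasMetricDeriv D g θ) (hD' : HasMetricDeriv D' g θ) {p : M} {X : VectorField4 M}
    (hX : VDiffAt X p) : D X p = D' X p := by
  obtain ⟨A, hA⟩ := difference_eq D D'
  have hsymm : ∀ u v, A p u v = A p v u := by
    intro u v
    have h1 := hA p _ (vdiffAt_ext4 u)
    have h2 := hA p _ (vdiffAt_ext4 v)
    have h3 := hT p u v
    rw [CovariantDerivative.torsion_apply_eq_extend, CovariantDerivative.torsion_apply_eq_extend]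
      at h3
    simp only [FiberBundle.extend_apply_self] at h3
    rw [ext4_self] at h1 h2
    rw [← h1, ← h2]
    simp only [sub_apply]
    have h4 : D (ext4 v) p u - D (ext4 u) p v = D' (ext4 v) p u - D' (ext4 u) p v := by
      simpa using h3
    rw [sub_eq_sub_iff_add_eq_add] at h4 ⊢
    rw [add_comm, ← h4, add_comm]
  have hskew : ∀ u v w, g.inner p (A p v u) w + g.inner p v (A p w u) = 0 := by
    intro u v w
    have h1 := hA p _ (vdiffAt_ext4 v)
    have h2 := hA p _ (vdiffAt_ext4 w)
    have h3 := hD p _ _ (vdiffAt_ext4 v) (vdiffAt_ext4 w) u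
    have h4 := hD' p _ _ (vdiffAt_ext4 v) (vdiffAt_ext4 w) u
    rw [ext4_self] at h1 h2
    simp only [covDerivMetric, ext4_self] at h3 h4
    rw [← h1, ← h2]
    simp only [sub_apply, map_sub]
    linarith
  -- The Koszul argument: a trilinear form symmetric in one pair of arguments and skew in another
  -- vanishes, by three cyclic instances.
  have hzero : ∀ u v, A p u v = 0 := by
    intro u v
    refine g.ext_inner fun w => ?_
    have h1 := hskew v u w
    have h2 := hskew u w v
    have h3 := hskew w v u
    rw [g.symm p u] at h1
    rw [g.symm p w] at h2
    rw [g.symm p v] at h3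
    rw [hsymm w v] at h1
    rw [hsymm v u] at h2
    rw [hsymm u w] at h3
    simp only [map_zero, zero_apply]
    linarith
  have h := hA p X hX
  rw [show A p (X p) = 0 from ContinuousLinearMap.ext fun v => hzero _ v] at h
  exact sub_eq_zero.mp h

end
end

/-! ### Adding the difference tensor to a connection: torsion, metric and curvature. -/

noncomputable section
section
variable {M : Type*} [TopologicalSpace M] [ChartedSpace E4 M] [IsManifold (𝓡 4) ∞ M]

section multilinear

variable (o : ManifoldOrientation M) (g : Metric4 M) (x : M) (r : ℝ)
  (a a' b b' c c' : TangentSpace (𝓡 4) x)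

lemma weylTensor_add_left : weylTensor o g x (a + a') b c =
    weylTensor o g x a b c + weylTensor o g x a' b c :=
  g.ext_inner fun d => by
    simp only [map_add, add_apply, inner_weylTensor,
      (isOrthonormal4_onBasis g x).vol4_eq_det4, coord4_add, det4_eq, Pi.add_apply]
    ring

lemma weylTensor_smul_left : weylTensor o g x (r • a) b c = r • weylTensor o g x a b c :=
  g.ext_inner fun d => by
    simp only [map_smul, smul_apply, inner_weylTensor, smul_eq_mul,
      (isOrthonormal4_onBasis g x).vol4_eq_det4, coord4_smul, det4_eq, Pi.smul_apply]
    ring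

lemma weylTensor_add_mid : weylTensor o g x a (b + b') c =
    weylTensor o g x a b c + weylTensor o g x a b' c :=
  g.ext_inner fun d => by
    simp only [map_add, add_apply, inner_weylTensor,
      (isOrthonormal4_onBasis g x).vol4_eq_det4, coord4_add, det4_eq, Pi.add_apply]
    ring

lemma weylTensor_smul_mid : weylTensor o g x a (r • b) c = r • weylTensor o g x a b c :=
  g.ext_inner fun d => by
    simp only [map_smul, smul_apply, inner_weylTensor, smul_eq_mul,
      (isOrthonormal4_onBasis g x).vol4_eq_det4, coord4_smul, det4_eq, Pi.smul_apply]
    ring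

lemma weylTensor_add_right : weylTensor o g x a b (c + c') =
    weylTensor o g x a b c + weylTensor o g x a b c' :=
  g.ext_inner fun d => by
    simp only [map_add, add_apply, inner_weylTensor,
      (isOrthonormal4_onBasis g x).vol4_eq_det4, coord4_add, det4_eq, Pi.add_apply]
    ring

lemma weylTensor_smul_right : weylTensor o g x a b (r • c) = r • weylTensor o g x a b c :=
  g.ext_inner fun d => by
    simp only [map_smul, smul_apply, inner_weylTensor, smul_eq_mul,
      (isOrthonormal4_onBasis g x).vol4_eq_det4, coord4_smul, det4_eq, Pi.smul_apply]
    ring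

lemma cross_add_mid : cross o g x a (b + b') c = cross o g x a b c + cross o g x a b' c :=
  g.ext_inner fun d => by
    simp only [map_add, add_apply, inner_cross,
      (isOrthonormal4_onBasis g x).vol4_eq_det4, coord4_add, det4_eq, Pi.add_apply]
    ring

lemma cross_smul_mid : cross o g x a (r • b) c = r • cross o g x a b c :=
  g.ext_inner fun d => by
    simp only [map_smul, smul_apply, inner_cross, smul_eq_mul,
      (isOrthonormal4_onBasis g x).vol4_eq_det4, coord4_smul, det4_eq, Pi.smul_apply]
    ring

/-- The three metric terms together are symmetric in `b` and `c`. The factor ½ is absorbed because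
the cross product is skew. -/
lemma weylTensor_sub_swap : weylTensor o g x a b c - weylTensor o g x a c b = cross o g x a b c :=
  g.ext_inner fun d => by
    simp only [map_sub, sub_apply, inner_cross, inner_weylTensor,
      (isOrthonormal4_onBasis g x).vol4_eq_det4, det4_eq, g.symm x c b]
    ring

/-- The cross product and the last two metric terms act by skew endomorphisms of `c`; only the
scalar part `-½ g(a, b)` remains, and it is counted twice. -/
lemma inner_weylTensor_add_swap : g.inner x (weylTensor o g x a b c) c' +
    g.inner x (weylTensor o g x a b c') c = -(g.inner x a b * g.inner x c c') := by
  simp only [inner_weylTensor, (isOrthonormal4_onBasis g x).vol4_eq_det4, det4_eq, g.symm x c' c]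
  ring

/-- `weylTensor` as a linear map in its second and third argument. -/
def weylBilin : TangentSpace (𝓡 4) x →ₗ[ℝ] TangentSpace (𝓡 4) x →ₗ[ℝ] TangentSpace (𝓡 4) x :=
  LinearMap.mk₂ ℝ (fun c b => weylTensor o g x a b c)
    (fun c c' b => weylTensor_add_right o g x a b c c')
    (fun r c b => weylTensor_smul_right o g x r a b c)
    (fun c b b' => weylTensor_add_mid o g x a b b' c)
    (fun r c b => weylTensor_smul_mid o g x r a b c)

/-- `weylTensor` as a continuous bilinear map in its second and third argument. -/
def weylMap : TangentSpace (𝓡 4) x →L[ℝ] TangentSpace (𝓡 4) x →L[ℝ] TangentSpace (𝓡 4) x :=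
  (LinearMap.toContinuousBilinearMap (𝕜 := ℝ) (E := E4) (F := E4) (G := E4) (weylBilin o g x a) : _)

/-- The trace of this linear map is the difference of the Ricci tensors of two connections, see
`IsWeylShift.ricci4_eq`. -/
def weylCurvature (o : ManifoldOrientation M) (g : Metric4 M) (x : M) (a : TangentSpace (𝓡 4) x)
    (L : TangentSpace (𝓡 4) x →ₗ[ℝ] TangentSpace (𝓡 4) x) (u v : TangentSpace (𝓡 4) x) :
    TangentSpace (𝓡 4) x →ₗ[ℝ] TangentSpace (𝓡 4) x where
  toFun w := weylTensor o g x (L w) u v - weylTensor o g x (L u) w v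
    + weylTensor o g x a (-cross o g x a w u) v + weylTensor o g x a w (weylTensor o g x a u v)
    - weylTensor o g x a u (weylTensor o g x a w v)
  map_add' w w' := by
    rw [map_add, weylTensor_add_left, weylTensor_add_mid, cross_add_mid, neg_add,
      weylTensor_add_mid, weylTensor_add_mid, weylTensor_add_mid, weylTensor_add_right]
    abel
  map_smul' r w := by
    rw [map_smul, weylTensor_smul_left, weylTensor_smul_mid, cross_smul_mid, ← smul_neg,
      weylTensor_smul_mid, weylTensor_smul_mid, weylTensor_smul_mid, weylTensor_smul_right,
      RingHom.id_apply]
    module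

end multilinear

/-- `D` is obtained from `N` by adding `weylTensor` of the vector field `ξ`. -/
def IsWeylShift (o : ManifoldOrientation M) (g : Metric4 M) (ξ : VectorField4 M)
    (N D : Connection4 M) : Prop :=
  ∀ (p : M) (Y : VectorField4 M), VDiffAt Y p → ∀ u : TangentSpace (𝓡 4) p,
    D Y p u = N Y p u + weylTensor o g p (ξ p) u (Y p)

lemma exists_weylShift (o : ManifoldOrientation M) (g : Metric4 M) (ξ : VectorField4 M)
    (N : Connection4 M) : ∃ D, IsWeylShift o g ξ N D :=
  ⟨N.addOneForm fun x => weylMap o g x (ξ x), fun _ _ _ _ => rfl⟩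

lemma exists_weylShift_to (o : ManifoldOrientation M) (g : Metric4 M) (ξ : VectorField4 M)
    (D : Connection4 M) : ∃ N, IsWeylShift o g ξ N D := by
  refine ⟨D.addOneForm fun x => -weylMap o g x (ξ x), fun p Y _ u => ?_⟩
  change D Y p u = (D Y p u + -(weylTensor o g p (ξ p) u (Y p))) + weylTensor o g p (ξ p) u (Y p)
  abel

namespace IsWeylShift

variable {o : ManifoldOrientation M} {g : Metric4 M} {ξ : VectorField4 M} {N D : Connection4 M}

lemma torsion (h : IsWeylShift o g ξ N D) (p : M) (u v : TangentSpace (𝓡 4) p) :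
    D.torsion p u v = N.torsion p u v + cross o g p (ξ p) u v := by
  rw [CovariantDerivative.torsion_apply_eq_extend, CovariantDerivative.torsion_apply_eq_extend]
  simp only [FiberBundle.extend_apply_self]
  have h1 := h p _ (vdiffAt_ext4 v) u
  have h2 := h p _ (vdiffAt_ext4 u) v
  rw [ext4_self] at h1 h2
  rw [h1, h2, ← weylTensor_sub_swap]
  abel

lemma covDerivMetric (h : IsWeylShift o g ξ N D) {p : M} {Y Z : VectorField4 M}
    (hY : VDiffAt Y p) (hZ : VDiffAt Z p) (u : TangentSpace (𝓡 4) p) :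
    _root_.covDerivMetric D g Y Z p u =
      _root_.covDerivMetric N g Y Z p u + g.inner p (ξ p) u * g.inner p (Y p) (Z p) := by
  have h1 := inner_weylTensor_add_swap o g p (ξ p) u (Y p) (Z p)
  have h2 := g.symm p (Y p) (weylTensor o g p (ξ p) u (Z p))
  simp only [_root_.covDerivMetric, h p Y hY, h p Z hZ, map_add, add_apply]
  linarith

lemma isSmoothConnection (h : IsWeylShift o g ξ N D) (hξ : VSmoothOn ξ Set.univ)
    (hN : IsSmoothConnection N) : IsSmoothConnection D := by
  rw [isSmoothConnection_iff] at hN ⊢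
  intro u X Y hu hX hY
  exact VSmoothOn.congr (VSmoothOn.add (hN u X Y hu hX hY)
    (weylTensor_vsmoothOn o g (hξ.mono (Set.subset_univ u)) hX hY))
    fun x hx => h x Y (hY.vdiffAt hu hx) _

lemma isSmoothConnection_of (h : IsWeylShift o g ξ N D) (hξ : VSmoothOn ξ Set.univ)
    (hD : IsSmoothConnection D) : IsSmoothConnection N := by
  rw [isSmoothConnection_iff] at hD ⊢
  intro u X Y hu hX hY
  refine VSmoothOn.congr (VSmoothOn.sub (hD u X Y hu hX hY)
    (weylTensor_vsmoothOn o g (hξ.mono (Set.subset_univ u)) hX hY)) fun x hx => ?_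
  rw [h x Y (hY.vdiffAt hu hx)]
  abel

/-- The difference of the curvatures. -/
lemma curvature4_eq (h : IsWeylShift o g ξ N D) (hξ : VSmoothOn ξ Set.univ)
    (hN : IsSmoothConnection N) (hg : HasMetricDeriv N g 0)
    (hT : ∀ (p : M) (u v : TangentSpace (𝓡 4) p), N.torsion p u v = -cross o g p (ξ p) u v)
    {p : M} {w : Set M} (hw : IsOpen w) (hp : p ∈ w) {X Y Z : VectorField4 M}
    (hX : VSmoothOn X w) (hY : VSmoothOn Y w) (hZ : VSmoothOn Z w) :
    curvature4 D X Y Z p = curvature4 N X Y Z p +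
      (weylTensor o g p (N ξ p (X p)) (Y p) (Z p) - weylTensor o g p (N ξ p (Y p)) (X p) (Z p)
      + weylTensor o g p (ξ p) (-cross o g p (ξ p) (X p) (Y p)) (Z p)
      + weylTensor o g p (ξ p) (X p) (weylTensor o g p (ξ p) (Y p) (Z p))
      - weylTensor o g p (ξ p) (Y p) (weylTensor o g p (ξ p) (X p) (Z p))) := by
  have hξp : VDiffAt ξ p := hξ.vdiffAt isOpen_univ (Set.mem_univ p)
  have hsm := (isSmoothConnection_iff N).mp hN
  have hXp := hX.vdiffAt hw hp
  have hYp := hY.vdiffAt hw hp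
  have hZp := hZ.vdiffAt hw hp
  -- Since the tensor is parallel, only its arguments are differentiated. When `A` and `B` are
  -- exchanged and the results subtracted, the terms with one derivative of `Z` cancel, and those
  -- with `N B` cancel against the Lie bracket.
  have second : ∀ {A B : VectorField4 M}, VSmoothOn A w → VSmoothOn B w →
      D (fun x => D Z x (B x)) p (A p) = N (fun x => N Z x (B x)) p (A p)
        + (weylTensor o g p (N ξ p (A p)) (B p) (Z p) + weylTensor o g p (ξ p) (N B p (A p)) (Z p)
          + weylTensor o g p (ξ p) (B p) (N Z p (A p)))
        + weylTensor o g p (ξ p) (A p) (N Z p (B p))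
        + weylTensor o g p (ξ p) (A p) (weylTensor o g p (ξ p) (B p) (Z p)) := by
    intro A B hA hB
    have hBp := hB.vdiffAt hw hp
    have h1 : VDiffAt (fun x => N Z x (B x)) p := (hsm w B Z hw hB hZ).vdiffAt hw hp
    obtain ⟨h2, h3⟩ := weylTensor_deriv o hg hξp hBp hZp (A p)
    have h4 : VDiffAt (fun x => N Z x (B x) + weylTensor o g x (ξ x) (B x) (Z x)) p := h1.add h2
    have hev : ∀ᶠ x in 𝓝 p, D Z x (B x) = N Z x (B x) + weylTensor o g x (ξ x) (B x) (Z x) :=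
      Filter.eventually_of_mem (hw.mem_nhds hp) fun x hx => h x Z (hZ.vdiffAt hw hx) _
    have h5 : VDiffAt (fun x => D Z x (B x)) p := h4.congr hev
    have h6 := D.isCovariantDerivativeOnUniv.congr_of_eventuallyEq h5 h4 Filter.univ_mem hev
    have h7 := N.isCovariantDerivativeOnUniv.add h1 h2
    have h8 : N (fun x => N Z x (B x) + weylTensor o g x (ξ x) (B x) (Z x)) p (A p) =
        N (fun x => N Z x (B x)) p (A p)
        + N (fun x => weylTensor o g x (ξ x) (B x) (Z x)) p (A p) :=
      congrArg (fun f => f (A p)) h7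
    rw [h6, h p _ h4, h8, h3, weylTensor_add_right]
    abel
  have hbr := mlieBracket_eq N hXp hYp
  rw [curvature4, curvature4, second hX hY, second hY hX, h p Z hZp]
  -- The bracket is `N_X Y - N_Y X` minus the torsion of `N`; this is the source of the term with a
  -- cross product inside the tensor.
  have h9 : weylTensor o g p (ξ p) (VectorField.mlieBracket (𝓡 4) X Y p) (Z p) =
      weylTensor o g p (ξ p) (N Y p (X p)) (Z p) - weylTensor o g p (ξ p) (N X p (Y p)) (Z p)
      - weylTensor o g p (ξ p) (-cross o g p (ξ p) (X p) (Y p)) (Z p) := by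
    rw [hbr, hT, sub_eq_add_neg, sub_eq_add_neg, weylTensor_add_mid, weylTensor_add_mid,
      ← neg_one_smul ℝ (N X p (Y p)), ← neg_one_smul ℝ (-cross o g p (ξ p) (X p) (Y p)),
      weylTensor_smul_mid, weylTensor_smul_mid]
    module
  rw [h9]
  abel

/-- The trace of the difference of the curvatures. -/
lemma ricci4_eq (h : IsWeylShift o g ξ N D) (hξ : VSmoothOn ξ Set.univ)
    (hN : IsSmoothConnection N) (hg : HasMetricDeriv N g 0)
    (hT : ∀ (p : M) (u v : TangentSpace (𝓡 4) p), N.torsion p u v = -cross o g p (ξ p) u v)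
    (p : M) (u v : TangentSpace (𝓡 4) p) :
    ricci4 D p u v = ricci4 N p u v + ∑ i, g.inner p
      (weylCurvature o g p (ξ p) (N ξ p) u v (onBasis g p i)) (onBasis g p i) := by
  rw [← (isOrthonormal4_onBasis g p).trace_eq (tangentBasis p)
    (weylCurvature o g p (ξ p) (N ξ p) u v), ricci4, ricci4,
    ← Finset.sum_add_distrib]
  refine Finset.sum_congr rfl fun i _ => ?_
  obtain ⟨w1, hw1, hp1, hs1⟩ := exists_smoothOn_ext4 (tangentBasis p i)
  obtain ⟨w2, hw2, hp2, hs2⟩ := exists_smoothOn_ext4 u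
  obtain ⟨w3, hw3, hp3, hs3⟩ := exists_smoothOn_ext4 v
  have hc := h.curvature4_eq hξ hN hg hT ((hw1.inter hw2).inter hw3) ⟨⟨hp1, hp2⟩, hp3⟩
    (hs1.mono fun x hx => hx.1.1) (hs2.mono fun x hx => hx.1.2) (hs3.mono fun x hx => hx.2)
  simp only [ext4_self] at hc
  rw [hc, map_add, Finsupp.add_apply]
  rfl

lemma symPart_ricci4 (h : IsWeylShift o g ξ N D) (hξ : VSmoothOn ξ Set.univ)
    (hN : IsSmoothConnection N) (hg : HasMetricDeriv N g 0)
    (hT : ∀ (p : M) (u v : TangentSpace (𝓡 4) p), N.torsion p u v = -cross o g p (ξ p) u v)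
    (p : M) (u v : TangentSpace (𝓡 4) p) :
    symPart (ricci4 D p) u v = symPart (ricci4 N p) u v
      + symPart (fun u v => g.inner p (N ξ p u) v) u v
      + (∑ i, g.inner p (N ξ p (onBasis g p i)) (onBasis g p i)) / 2 * g.inner p u v := by
  have htr := weylTensor_trace o g p (ξ p) (N ξ p) (isOrthonormal4_onBasis g p)
    (fun w u v => weylCurvature o g p (ξ p) (N ξ p) u v w) (fun _ _ _ => rfl) u v
  have h2 : symPart (ricci4 D p) u v = symPart (ricci4 N p) u v +
      symPart (fun u v => ∑ i, g.inner p
        (weylCurvature o g p (ξ p) (N ξ p) u v (onBasis g p i)) (onBasis g p i)) u v := by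
    simp only [symPart, h.ricci4_eq hξ hN hg hT]
    ring
  rw [h2, htr]
  simp only [ContinuousLinearMap.coe_coe]
  ring

end IsWeylShift

/-- A metric connection commutes with the duality between vectors and 1-forms. -/
lemma covDerivOneForm_eq {N : Connection4 M} {g : Metric4 M} (hg : HasMetricDeriv N g 0)
    {ξ : VectorField4 M} {θ : Form4 M 1} (hθ : ∀ x v, θ x ![v] = g.inner x (ξ x) v) {p : M}
    (hξ : VDiffAt ξ p) (u v : TangentSpace (𝓡 4) p) :
    covDerivOneForm N θ p u v = g.inner p (N ξ p u) v := by
  simp only [covDerivOneForm, hθ]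
  rw [inner_deriv hg hξ (vdiffAt_ext4 v), ext4_self]
  ring

end
end

/-! ### The exterior derivative of the torsion form. -/

noncomputable section
section
variable {M : Type*} [TopologicalSpace M] [ChartedSpace E4 M] [IsManifold (𝓡 4) ∞ M]

lemma extDeriv4_three_apply (H : Form4 M 3) (p : M) (v : Fin 4 → TangentSpace (𝓡 4) p) :
    extDeriv4 H p v =
      mvfderiv (𝓡 4) (fun x => H x ![ext4 (v 1) x, ext4 (v 2) x, ext4 (v 3) x]) p (v 0)
      - mvfderiv (𝓡 4) (fun x => H x ![ext4 (v 0) x, ext4 (v 2) x, ext4 (v 3) x]) p (v 1)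
      + mvfderiv (𝓡 4) (fun x => H x ![ext4 (v 0) x, ext4 (v 1) x, ext4 (v 3) x]) p (v 2)
      - mvfderiv (𝓡 4) (fun x => H x ![ext4 (v 0) x, ext4 (v 1) x, ext4 (v 2) x]) p (v 3)
      - H p ![VectorField.mlieBracket (𝓡 4) (ext4 (v 0)) (ext4 (v 1)) p, v 2, v 3]
      + H p ![VectorField.mlieBracket (𝓡 4) (ext4 (v 0)) (ext4 (v 2)) p, v 1, v 3]
      - H p ![VectorField.mlieBracket (𝓡 4) (ext4 (v 0)) (ext4 (v 3)) p, v 1, v 2]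
      - H p ![VectorField.mlieBracket (𝓡 4) (ext4 (v 1)) (ext4 (v 2)) p, v 0, v 3]
      + H p ![VectorField.mlieBracket (𝓡 4) (ext4 (v 1)) (ext4 (v 3)) p, v 0, v 2]
      - H p ![VectorField.mlieBracket (𝓡 4) (ext4 (v 2)) (ext4 (v 3)) p, v 0, v 1] := by
  have r0 : ∀ x, (0 : Fin 4).removeNth (fun l => ext4 (v l) x) =
      ![ext4 (v 1) x, ext4 (v 2) x, ext4 (v 3) x] := fun x => by ext i; fin_cases i <;> rfl
  have r1 : ∀ x, (1 : Fin 4).removeNth (fun l => ext4 (v l) x) =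
      ![ext4 (v 0) x, ext4 (v 2) x, ext4 (v 3) x] := fun x => by ext i; fin_cases i <;> rfl
  have r2 : ∀ x, (2 : Fin 4).removeNth (fun l => ext4 (v l) x) =
      ![ext4 (v 0) x, ext4 (v 1) x, ext4 (v 3) x] := fun x => by ext i; fin_cases i <;> rfl
  have r3 : ∀ x, (3 : Fin 4).removeNth (fun l => ext4 (v l) x) =
      ![ext4 (v 0) x, ext4 (v 1) x, ext4 (v 2) x] := fun x => by ext i; fin_cases i <;> rfl
  have s00 : (0 : Fin 3).removeNth ((0 : Fin 4).removeNth v) = ![v 2, v 3] := by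
    ext i; fin_cases i <;> rfl
  have s01 : (1 : Fin 3).removeNth ((0 : Fin 4).removeNth v) = ![v 1, v 3] := by
    ext i; fin_cases i <;> rfl
  have s02 : (2 : Fin 3).removeNth ((0 : Fin 4).removeNth v) = ![v 1, v 2] := by
    ext i; fin_cases i <;> rfl
  have s11 : (1 : Fin 3).removeNth ((1 : Fin 4).removeNth v) = ![v 0, v 3] := by
    ext i; fin_cases i <;> rfl
  have s12 : (2 : Fin 3).removeNth ((1 : Fin 4).removeNth v) = ![v 0, v 2] := by
    ext i; fin_cases i <;> rfl
  have s22 : (2 : Fin 3).removeNth ((2 : Fin 4).removeNth v) = ![v 0, v 1] := by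
    ext i; fin_cases i <;> rfl
  have g0 : Finset.Ici (0 : Fin 3) = {0, 1, 2} := by decide
  have g1 : Finset.Ici (1 : Fin 3) = {1, 2} := by decide
  have g2 : Finset.Ici (2 : Fin 3) = {2} := by decide
  have c0 : (0 : Fin 3).castSucc = 0 := rfl
  have c1 : (1 : Fin 3).castSucc = 1 := rfl
  have c2 : (2 : Fin 3).castSucc = 2 := rfl
  have d0 : (0 : Fin 3).succ = 1 := rfl
  have d1 : (1 : Fin 3).succ = 2 := rfl
  have d2 : (2 : Fin 3).succ = 3 := rfl
  have v0 : ((0 : Fin 4) : ℕ) = 0 := rfl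
  have v1 : ((1 : Fin 4) : ℕ) = 1 := rfl
  have v2 : ((2 : Fin 4) : ℕ) = 2 := rfl
  have v3 : ((3 : Fin 4) : ℕ) = 3 := rfl
  have w0 : ((0 : Fin 3) : ℕ) = 0 := rfl
  have w1 : ((1 : Fin 3) : ℕ) = 1 := rfl
  have w2 : ((2 : Fin 3) : ℕ) = 2 := rfl
  rw [extDeriv4]
  simp only [Nat.reduceAdd]
  rw [Fin.sum_univ_four, Fin.sum_univ_three]
  simp only [r0, r1, r2, r3, g0, g1, g2, c0, c1, c2, v0, v1, v2, v3, w0, w1, w2]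
  rw [Finset.sum_insert (by decide), Finset.sum_insert (by decide), Finset.sum_singleton,
    Finset.sum_insert (by decide), Finset.sum_singleton, Finset.sum_singleton]
  simp only [d0, d1, d2, w0, w1, w2, s00, s01, s02, s11, s12, s22]
  ring

/-- The volume form is parallel, so the derivative falls on `ξ` and the three arguments only. -/
lemma mvfderiv_form_three (o : ManifoldOrientation M) {N : Connection4 M} {g : Metric4 M}
    (hg : HasMetricDeriv N g 0) {ξ : VectorField4 M} {H : Form4 M 3}
    (hH : ∀ x u v w, H x ![u, v, w] = -vol4 o g x ![ξ x, u, v, w]) {p : M} (hξ : VDiffAt ξ p)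
    {A B C : VectorField4 M} (hA : VDiffAt A p) (hB : VDiffAt B p) (hC : VDiffAt C p)
    (v : TangentSpace (𝓡 4) p) :
    mvfderiv (𝓡 4) (fun x => H x ![A x, B x, C x]) p v =
      -(vol4 o g p ![N ξ p v, A p, B p, C p] + vol4 o g p ![ξ p, N A p v, B p, C p]
      + vol4 o g p ![ξ p, A p, N B p v, C p] + vol4 o g p ![ξ p, A p, B p, N C p v]) := by
  have h := (HasDirDeriv.const (0 : ℝ)).sub (vol4_vec_deriv o hg hξ hA hB hC v)
  simp only [zero_sub] at h
  simp only [hH]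
  exact h.2

/-- The exterior derivative of the torsion 3-form in terms of the divergence of its dual. -/
lemma star4_extDeriv4 (o : ManifoldOrientation M) {N : Connection4 M} {g : Metric4 M}
    (hg : HasMetricDeriv N g 0) {ξ : VectorField4 M} {H : Form4 M 3}
    (hT : ∀ (p : M) (u v : TangentSpace (𝓡 4) p), N.torsion p u v = -cross o g p (ξ p) u v)
    (hH : ∀ x u v w, H x ![u, v, w] = -vol4 o g x ![ξ x, u, v, w]) {p : M} (hξ : VDiffAt ξ p) :
    star4 o g (k := 4) (m := 0) rfl (extDeriv4 H) p ![] =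
      -∑ i, g.inner p (N ξ p (onBasis g p i)) (onBasis g p i) := by
  have he := isOrthonormal4_onBasis g p
  have hs := he.vol4_sq o
  have hd : ∀ i, VDiffAt (ext4 (onBasis g p i)) p := fun i => vdiffAt_ext4 _
  rw [star4_four_apply]
  have hc : ∀ i, g.inner p (N ξ p (onBasis g p i)) (onBasis g p i) =
      coord4 g (onBasis g p) (N ξ p (onBasis g p i)) i := fun i => g.symm p _ _
  -- The derivatives of the extended basis fields cancel against the torsion-free parts of the
  -- brackets. The torsion parts are quadratic in `ξ` and sum to zero, which leaves the divergence.
  have key : extDeriv4 H p (onBasis g p) =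
      -(∑ i, g.inner p (N ξ p (onBasis g p i)) (onBasis g p i)) * vol4 o g p (onBasis g p) := by
    rw [extDeriv4_three_apply, mvfderiv_form_three o hg hH hξ (hd 1) (hd 2) (hd 3),
      mvfderiv_form_three o hg hH hξ (hd 0) (hd 2) (hd 3),
      mvfderiv_form_three o hg hH hξ (hd 0) (hd 1) (hd 3),
      mvfderiv_form_three o hg hH hξ (hd 0) (hd 1) (hd 2)]
    simp only [hH, mlieBracket_eq N (hd _) (hd _), hT, ext4_self]
    simp only [hc, Fin.sum_univ_four, he.vol4_eq_det4, he.coord4_self, coord4_sub, coord4_neg,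
      he.coord4_cross, det4_eq, cross4, Pi.sub_apply, Pi.neg_apply, Pi.smul_apply, smul_eq_mul,
      Pi.single_apply, Fin.isValue, Fin.reduceEq, if_true, if_false]
    ring
  rw [key, mul_assoc, hs, mul_one]

end
end

/-! ### The Ricci identity, and smoothness of dual fields and forms. -/

noncomputable section
section
variable {M : Type*} [TopologicalSpace M] [ChartedSpace E4 M] [IsManifold (𝓡 4) ∞ M]

/-- The Einstein equation with skew torsion is the Einstein–Weyl equation. -/
lemma IsWeylShift.symTraceFree_ricci4 {o : ManifoldOrientation M} {g : Metric4 M}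
    {ξ : VectorField4 M} {N D : Connection4 M} (h : IsWeylShift o g ξ N D)
    (hξ : VSmoothOn ξ Set.univ) (hN : IsSmoothConnection N) (hg : HasMetricDeriv N g 0)
    (hT : ∀ (p : M) (u v : TangentSpace (𝓡 4) p), N.torsion p u v = -cross o g p (ξ p) u v)
    {H : Form4 M 3} (hH : ∀ x u v w, H x ![u, v, w] = -vol4 o g x ![ξ x, u, v, w])
    (p : M) (u v : TangentSpace (𝓡 4) p) :
    symTraceFree g p (ricci4 D p) u v = symTraceFree g p (ricci4 N p) u v
      + symPart (covDerivOneForm N (star4 o g (k := 3) (m := 1) rfl fun x => H x) p) u v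
      + star4 o g (k := 4) (m := 0) rfl (extDeriv4 H) p ![] / 4 * g.inner p u v := by
  have hξp : VDiffAt ξ p := hξ.vdiffAt isOpen_univ (Set.mem_univ p)
  have hS : covDerivOneForm N (star4 o g (k := 3) (m := 1) rfl fun x => H x) p =
      fun u v => g.inner p (N ξ p u) v := by
    ext u v
    exact covDerivOneForm_eq hg (fun x v => star4_three_of_eq o g H x (ξ x) (hH x) v) hξp u v
  rw [symTraceFree_eq_add g p _ _ _ _ (h.symPart_ricci4 hξ hN hg hT p) u v,
    star4_extDeriv4 o hg hT hH hξp, metricTrace_eq, hS]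
  ring

/-! ### Smoothness of dual fields and forms -/

lemma vsmoothOn_of_inner_of_smooth (g : Metric4 M) (o : ManifoldOrientation M)
    {ξ : VectorField4 M} (h : ∀ (u : Set M) (E : Fin 4 → VectorField4 M), IsOpen u →
      (∀ i, VSmoothOn (E i) u) → (∀ x ∈ u, IsOrthonormal4 g x fun i => E i x) →
      (∃ s, ∀ x ∈ u, vol4 o g x (fun i => E i x) = s) →
      ∀ i, FSmoothOn (fun x => g.inner x (E i x) (ξ x)) u) : VSmoothOn ξ Set.univ := by
  refine VSmoothOn.of_locally fun p _ => ?_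
  obtain ⟨u, hu, hpu, E, hE, hon, hv⟩ := exists_orthonormal_frame o g p
  refine ⟨u, hu, hpu, ?_⟩
  rw [Set.univ_inter]
  exact vsmoothOn_of_inner g hE hon (h u E hu hE hon ⟨_, hv⟩)

lemma IsSmoothForm.vsmoothOn_sharp {θ : Form4 M 1} (hθ : IsSmoothForm θ) (g : Metric4 M)
    (o : ManifoldOrientation M) : VSmoothOn (sharp g θ) Set.univ := by
  refine vsmoothOn_of_inner_of_smooth g o fun u E hu hE _ _ i => ?_
  refine (hθ u ![E i] hu fun j => ?_).congr fun x _ => ?_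
  · fin_cases j
    exact hE i
  · rw [g.symm, inner_sharp]
    congr 1
    ext j; fin_cases j; rfl

lemma IsSmoothForm.vsmoothOn_sharp_star4 {H : Form4 M 3} (hH : IsSmoothForm H) (g : Metric4 M)
    (o : ManifoldOrientation M) :
    VSmoothOn (sharp g (star4 o g (k := 3) (m := 1) rfl fun x => H x)) Set.univ := by
  refine vsmoothOn_of_inner_of_smooth g o fun u E hu hE hon ⟨s, hv⟩ i => ?_
  set ξ := sharp g (star4 o g (k := 3) (m := 1) rfl fun x => H x) with hξ
  have hsm : ∀ a b c : Fin 4, FSmoothOn (fun x => H x ![E a x, E b x, E c x]) u := by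
    intro a b c
    refine (hH u ![E a, E b, E c] hu fun j => ?_).congr fun x _ => ?_
    · fin_cases j
      exacts [hE a, hE b, hE c]
    · congr 1
      ext j; fin_cases j <;> rfl
  -- By `H = -vol(ξ, ·, ·, ·)`, the value of `H` on the three frame fields complementary to `E i`
  -- is, up to sign, the `i`-th component of `ξ`. This exhibits the components as smooth functions;
  -- `r` is the sign of the cofactor.
  have hval : ∀ x ∈ u, ∀ a b c : Fin 4, H x ![E a x, E b x, E c x] =
      -(det4 (coord4 g (fun i => E i x) (ξ x)) (Pi.single a 1) (Pi.single b 1)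
        (Pi.single c 1) * s) := by
    intro x hx a b c
    have he := hon x hx
    rw [form_three_eq_neg_volContract o g H x, AlternatingMap.neg_apply, volContract_apply,
      he.vol4_eq_det4, ← hv x hx, ← he.coord4_self a, ← he.coord4_self b, ← he.coord4_self c, mul_comm]
  have hs : ∀ x ∈ u, s * s = 1 := fun x hx => hv x hx ▸ (hon x hx).vol4_sq o
  have hfin : ∀ (r : ℝ) (a b c : Fin 4), (∀ t : Fin 4 → ℝ, det4 t (Pi.single a 1) (Pi.single b 1)
      (Pi.single c 1) = r * t i) → r * r = 1 →
      FSmoothOn (fun x => g.inner x (E i x) (ξ x)) u := by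
    intro r a b c ht hr
    have h0 : FSmoothOn (fun _ => -(r * s)) u := contMDiffOn_const
    have h1 : FSmoothOn (fun x => -(r * s) * H x ![E a x, E b x, E c x]) u := h0.smul (hsm a b c)
    refine h1.congr fun x hx => ?_
    rw [hval x hx, ht]
    change coord4 g (fun i => E i x) (ξ x) i = _
    linear_combination (-coord4 g (fun i => E i x) (ξ x) i * s * s) * hr -
      coord4 g (fun i => E i x) (ξ x) i * hs x hx
  fin_cases i
  · exact hfin 1 1 2 3 (fun t => by simp [det4_eq]) (by norm_num)
  · exact hfin (-1) 0 2 3 (fun t => by simp [det4_eq]) (by norm_num)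
  · exact hfin 1 0 1 3 (fun t => by simp [det4_eq]) (by norm_num)
  · exact hfin (-1) 0 1 2 (fun t => by simp [det4_eq]) (by norm_num)

lemma isSmoothForm_three_of_vsmoothOn {o : ManifoldOrientation M} {g : Metric4 M}
    {ξ : VectorField4 M} (hξ : VSmoothOn ξ Set.univ) {H : Form4 M 3}
    (hH : ∀ x u v w, H x ![u, v, w] = -vol4 o g x ![ξ x, u, v, w]) : IsSmoothForm H := by
  intro u X hu hX
  have h : FSmoothOn (fun x => vol4 o g x (fun i => (![ξ, X 0, X 1, X 2] : Fin 4 → _) i x)) u := by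
    refine vol4_fsmoothOn o g fun i => ?_
    fin_cases i
    exacts [hξ.mono (Set.subset_univ u), hX 0, hX 1, hX 2]
  refine h.neg.congr fun x _ => ?_
  have h1 : (fun i => X i x) = ![X 0 x, X 1 x, X 2 x] := by
    ext j; fin_cases j <;> rfl
  rw [h1, hH]
  congr 2
  ext j; fin_cases j <;> rfl

end
end

/-! ### Smoothness of the Weyl form, conformal invariance, and the correspondence. -/

noncomputable section
section
variable {M : Type*} [TopologicalSpace M] [ChartedSpace E4 M] [IsManifold (𝓡 4) ∞ M]

/-! ### The Weyl form -/

/-- Applied to a smooth unit field `E`, the equation `Dg = θ ⊗ g` gives `θ(X) = -2 g(D_X E, E)`. -/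
lemma IsSmoothConnection.isSmoothForm {D : Connection4 M} (hD : IsSmoothConnection D)
    (o : ManifoldOrientation M) {g : Metric4 M} {θ : Form4 M 1} (hθ : HasMetricDeriv D g θ) :
    IsSmoothForm θ := by
  rw [isSmoothConnection_iff] at hD
  intro u X hu hX
  refine FSmoothOn.of_locally fun p _ => ?_
  obtain ⟨w, hw, hpw, E, hE, hon, -⟩ := exists_orthonormal_frame o g p
  refine ⟨w, hw, hpw, ?_⟩
  have hE0 : VSmoothOn (E 0) (u ∩ w) := (hE 0).mono Set.inter_subset_right
  have h1 := g.fsmoothOn (hD (u ∩ w) (X 0) (E 0) (hu.inter hw)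
    ((hX 0).mono Set.inter_subset_left) hE0) hE0
  have h0 : FSmoothOn (fun _ => (-2 : ℝ)) (u ∩ w) := contMDiffOn_const
  have h2 : FSmoothOn (fun x => -2 * g.inner x (D (E 0) x (X 0 x)) (E 0 x)) (u ∩ w) := h0.smul h1
  refine h2.congr fun x hx => ?_
  have h3 := (hE 0).vdiffAt hw hx.2
  have h4 := hθ x (E 0) (E 0) h3 h3 (X 0 x)
  have h5 : mvfderiv (𝓡 4) (fun y => g.inner y (E 0 y) (E 0 y)) x (X 0 x) = 0 := by
    rw [mvfderiv_congr (f' := fun _ => (1 : ℝ)) (Filter.eventually_of_mem (hw.mem_nhds hx.2)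
      fun y hy => by simpa using hon y hy 0 0)]
    exact (HasDirDeriv.const 1).2
  have h6 : g.inner x (E 0 x) (E 0 x) = 1 := by simpa using hon x hx.2 0 0
  have h7 : (fun i => X i x) = ![X 0 x] := by
    ext j; fin_cases j; rfl
  rw [covDerivMetric, h5, h6, g.symm x (E 0 x)] at h4
  rw [h7]
  linarith

/-! ### Conformal changes -/

/-- The condition says that the symmetric part of `B` is a multiple of the metric, which does not
depend on the scale. -/
lemma symTraceFree_eq_zero_of_conformal {g g' : Metric4 M} {x : M} {r : ℝ} (hr : r ≠ 0)
    (h : g'.inner x = r • g.inner x) {B : TangentSpace (𝓡 4) x → TangentSpace (𝓡 4) x → ℝ}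
    (hB : ∀ u v, symTraceFree g x B u v = 0) (u v : TangentSpace (𝓡 4) x) :
    symTraceFree g' x B u v = 0 := by
  have h' : ∀ u v, g'.inner x u v = r * g.inner x u v := fun u v => by rw [h]; rfl
  have h1 : ∀ u v, symPart B u v = metricTrace g x (symPart B) / 4 / r * g'.inner x u v := by
    intro u v
    have := hB u v
    rw [symTraceFree] at this
    rw [h', ← mul_assoc, div_mul_cancel₀ _ hr]
    linarith
  have h2 : metricTrace g' x (symPart B) = metricTrace g x (symPart B) / r := by
    have h3 : ∀ i, g'.inner x (onBasis g' x i) (onBasis g' x i) = 1 := fun i => by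
      simpa using isOrthonormal4_onBasis g' x i i
    rw [metricTrace_eq g', Fin.sum_univ_four, h1, h1 (onBasis g' x 1), h1 (onBasis g' x 2),
      h1 (onBasis g' x 3), h3, h3, h3, h3]
    ring
  rw [symTraceFree, h2, h1 u v]
  ring

lemma HasMetricDeriv.exists_of_conformal {D : Connection4 M} {g g' : Metric4 M} {θ : Form4 M 1}
    (hD : HasMetricDeriv D g θ) {f : M → ℝ} (hf : ContMDiff (𝓡 4) 𝓘(ℝ) ∞ f)
    (h : ∀ x, g'.inner x = Real.exp (f x) • g.inner x) : ∃ θ', HasMetricDeriv D g' θ' := by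
  let φ : M → ℝ := fun x => Real.exp (f x)
  have hφ : ∀ p, FDiffAt φ p := fun p =>
    (Real.contDiff_exp.contMDiff.comp hf).mdifferentiable (by simp) p
  -- For `g' = φ g` the product rule adds the logarithmic derivative `dφ / φ` to `θ`.
  let η : Form4 M 1 := fun x => AlternatingMap.ofSubsingleton ℝ (TangentSpace (𝓡 4) x) ℝ (0 : Fin 1)
    ((φ x)⁻¹ • (mvfderiv (𝓡 4) φ x).toLinearMap)
  have hη : ∀ x v, η x ![v] = (φ x)⁻¹ * mvfderiv (𝓡 4) φ x v := fun x v => rfl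
  have h' : ∀ x u v, g'.inner x u v = φ x * g.inner x u v := fun x u v => by rw [h x]; rfl
  refine ⟨θ + η, fun p Y Z hY hZ u => ?_⟩
  have h1 := hD p Y Z hY hZ u
  have h2 := (HasDirDeriv.mul (v := u) ⟨hφ p, rfl⟩ ⟨g.fdiffAt hY hZ, rfl⟩).2
  have h3 : φ p * (φ p)⁻¹ = 1 := mul_inv_cancel₀ (Real.exp_ne_zero _)
  have h4 : (θ + η) p ![u] = θ p ![u] + η p ![u] := rfl
  rw [covDerivMetric] at h1
  simp only [covDerivMetric, h']
  rw [h2, h4, hη]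
  linear_combination φ p * h1 - mvfderiv (𝓡 4) φ p u * g.inner p (Y p) (Z p) * h3

/-- It suffices to check the Einstein–Weyl condition for one metric of the conformal class. -/
lemma isEinsteinWeyl_conformalClass (o : ManifoldOrientation M) {D : Connection4 M}
    {g : Metric4 M} {θ : Form4 M 1} (hs : IsSmoothConnection D) (hT : D.torsion = 0)
    (hD : HasMetricDeriv D g θ) (hE : ∀ p u v, symTraceFree g p (ricci4 D p) u v = 0) :
    IsEinsteinWeyl (conformalClass g) D := by
  have hc : ∀ g' : Metric4 M, conformalClass g' = conformalClass g →
      ∃ f : M → ℝ, ContMDiff (𝓡 4) 𝓘(ℝ) ∞ f ∧ ∀ x, g'.inner x = Real.exp (f x) • g.inner x :=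
    fun g' h => Quotient.exact h.symm
  refine ⟨⟨hs, hT, fun g' h => ?_⟩, fun g' h p u v => ?_⟩
  · obtain ⟨f, hf, hg⟩ := hc g' h
    obtain ⟨θ', hθ'⟩ := hD.exists_of_conformal hf hg
    exact ⟨θ', hs.isSmoothForm o hθ', hθ'⟩
  · obtain ⟨f, hf, hg⟩ := hc g' h
    exact symTraceFree_eq_zero_of_conformal (Real.exp_ne_zero _) (hg p) (hE p) u v

/-! ### The correspondence -/

lemma IsWeylShift.hasMetricDeriv_iff {o : ManifoldOrientation M} {g : Metric4 M} {θ : Form4 M 1}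
    {N D : Connection4 M} (h : IsWeylShift o g (sharp g θ) N D) :
    HasMetricDeriv D g θ ↔ HasMetricDeriv N g 0 := by
  refine forall_congr' fun p => forall_congr' fun Y => forall_congr' fun Z => ?_
  refine forall_congr' fun hY => forall_congr' fun hZ => forall_congr' fun u => ?_
  rw [h.covDerivMetric hY hZ, inner_sharp]
  change _ ↔ _ = 0 * _
  rw [zero_mul]
  constructor <;> intro h <;> linarith

lemma torsion_eq_neg_cross {o : ManifoldOrientation M} {g : Metric4 M} {ξ : VectorField4 M}
    {H : Form4 M 3} (hH : ∀ x u v w, H x ![u, v, w] = -vol4 o g x ![ξ x, u, v, w])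
    {N : Connection4 M} (hN : IsSkewTorsionConnection g H N) (p : M)
    (u v : TangentSpace (𝓡 4) p) : N.torsion p u v = -cross o g p (ξ p) u v :=
  g.ext_inner fun z => by rw [hN.torsion, hH, map_neg, neg_apply, inner_cross]

end
end

theorem mainTheorem3 {M : Type*} [TopologicalSpace M] [T2Space M] [SecondCountableTopology M]
    [ChartedSpace E4 M] [IsManifold (𝓡 4) ∞ M] (o : ManifoldOrientation M) :
    (∀ (g : Metric4 M) (H : Form4 M 3) (θ : Form4 M 1),
      IsEinsteinSkewTorsion o g H →
      θ = star4 o g (k := 3) (m := 1) rfl (fun x => H x) →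
        (∃ D : Connection4 M, IsSmoothConnection D ∧ D.torsion = 0 ∧ HasMetricDeriv D g θ) ∧
        (∀ D D' : Connection4 M, D.torsion = 0 → HasMetricDeriv D g θ →
          D'.torsion = 0 → HasMetricDeriv D' g θ →
          ∀ (p : M) (X : VectorField4 M),
            MDifferentiableAt (𝓡 4) (𝓡 4).tangent
              (fun x => (⟨x, X x⟩ : TangentBundle (𝓡 4) M)) p →
            D X p = D' X p) ∧
        (∀ D : Connection4 M, D.torsion = 0 → HasMetricDeriv D g θ →
          IsEinsteinWeyl (conformalClass g) D)) ∧
    (∀ (c : ConformalStructure M) (D : Connection4 M), IsEinsteinWeyl c D →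
      ∀ (g : Metric4 M) (θ : Form4 M 1), conformalClass g = c → HasMetricDeriv D g θ →
        IsEinsteinSkewTorsion o g (-star4 o g (k := 1) (m := 3) rfl (fun x => θ x))) := by
  refine ⟨?_, ?_⟩
  · rintro g H θ ⟨hHs, N, hN, heq⟩ rfl
    set θ := star4 o g (k := 3) (m := 1) rfl (fun x => H x) with hθ
    have hξ : VSmoothOn (sharp g θ) Set.univ := hHs.vsmoothOn_sharp_star4 g o
    have hH : ∀ x u v w, H x ![u, v, w] = -vol4 o g x ![sharp g θ x, u, v, w] := by
      intro x u v w
      rw [form_three_eq_neg_volContract o g H x, AlternatingMap.neg_apply, volContract_apply]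
    have hT := torsion_eq_neg_cross hH hN
    have huniq : ∀ D D' : Connection4 M, D.torsion = 0 → HasMetricDeriv D g θ →
        D'.torsion = 0 → HasMetricDeriv D' g θ → ∀ (p : M) (X : VectorField4 M), VDiffAt X p →
        D X p = D' X p := fun D D' h1 h2 h3 h4 p X hX =>
      connection_unique (fun p u v => by rw [h1, h3]) h2 h4 hX
    obtain ⟨D₀, h₀⟩ := exists_weylShift o g (sharp g θ) N
    have hs : IsSmoothConnection D₀ := h₀.isSmoothConnection hξ hN.smooth
    have hT₀ : D₀.torsion = 0 := by
      ext p u v : 3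
      rw [h₀.torsion, hT]
      exact neg_add_cancel _
    have hg : HasMetricDeriv D₀ g θ := h₀.hasMetricDeriv_iff.mpr hN.metric
    refine ⟨⟨D₀, hs, hT₀, hg⟩, huniq, fun D hDT hDg => ?_⟩
    -- An arbitrary solution `D`, not assumed smooth, agrees with `D₀` on fields differentiable at
    -- the point. That is all a shift requires, and smoothness of `D` then follows from that of `N`.
    have h : IsWeylShift o g (sharp g θ) N D := fun p Y hY u => by
      rw [huniq D D₀ hDT hDg hT₀ hg p Y hY, h₀ p Y hY]
    refine isEinsteinWeyl_conformalClass o (h.isSmoothConnection hξ hN.smooth) hDT hDg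
      fun p u v => ?_
    rw [h.symTraceFree_ricci4 hξ hN.smooth hN.metric hT hH]
    exact heq p u v
  · intro c D hD g θ hc hg
    have hξ : VSmoothOn (sharp g θ) Set.univ :=
      -- The given `θ` carries no smoothness assumption; it is inherited from `D`.
      (hD.weyl.smooth.isSmoothForm o hg).vsmoothOn_sharp g o
    obtain ⟨N, h⟩ := exists_weylShift_to o g (sharp g θ) D
    have hH : ∀ x u v w, (-star4 o g (k := 1) (m := 3) rfl (fun x => θ x)) x ![u, v, w] =
        -vol4 o g x ![sharp g θ x, u, v, w] := by
      intro x u v w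
      rw [← star4_one_eq]
      rfl
    have hT : ∀ (p : M) (u v : TangentSpace (𝓡 4) p),
        N.torsion p u v = -cross o g p (sharp g θ p) u v := by
      intro p u v
      have h1 := h.torsion p u v
      rw [hD.weyl.torsion_free] at h1
      exact eq_neg_of_add_eq_zero_left h1.symm
    have hN : IsSmoothConnection N := h.isSmoothConnection_of hξ hD.weyl.smooth
    have hNg : HasMetricDeriv N g 0 := h.hasMetricDeriv_iff.mp hg
    refine ⟨isSmoothForm_three_of_vsmoothOn hξ hH, N, ⟨hN, hNg, fun p u v w => ?_⟩,
      fun p u v => ?_⟩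
    · rw [hT, hH, map_neg, neg_apply, inner_cross]
    · rw [← h.symTraceFree_ricci4 hξ hN hNg hT hH]
      exact hD.einstein g hc p u v
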